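/- For $N\ge 0$ let $\omega_N=\frac{\sqrt{-1}}{2\pi}\partial\bar\partial\log(1+\|z\|^2)$ denote the $(1,1)$-form of the Fubini–Study metric in the affine chart $\mathbb C^N\subset\mathbb{CP}^N$, $z\mapsto[1:z]$. A mapping $g\colon\Omega\to\mathbb C^N\subset\mathbb{CP}^N$ is called minimally embedded if its image is not contained in a proper projective plane of $\mathbb{CP}^N$ (equivalently, in a proper complex affine subspace of $\mathbb C^N$). For a mapping $\psi\colon\Omega\to\mathbb C^s$, $\psi^{\otimes k}$ is the mapping $\Omega\to\mathbb C^{s^k}$ whose components are all products $\psi_{j_1}\cdots\psi_{j_k}$, $1\le j_1,\dots,j_k\le s$, and the rank of $\psi$ is the dimension of the complex vector space of functions on $\Omega$ spanned by the components of $\psi$ (equivalently, of the smallest linear subspace of $\mathbb C^s$ containing $\psi(\Omega)$). Let $\Omega\subset\mathbb C^n\subset\mathbb{CP}^n$ be a non-empty connected open set, let $a,b,c$ be positive integers without a common prime factor, i.e. $\gcd(a,b,c)=1$, and let $f\colon\Omega\to\mathbb C^d\subset\mathbb{CP}^d$ and $h\colon\Omega\to\mathbb C^m\subset\mathbb{CP}^m$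 be minimally embedded holomorphic mappings such that on $\Omega$ $$\omega_n=\frac ab\,h^*\omega_m-\frac cb\,f^*\omega_d .$$ If $(1,f)^{\otimes c}$ has rank $e+1$, then $$cd\le e\le\sum_{k=1}^c\binom{d+k-1}{k},$$ and the following hold. (i) If $e\le n$ and $b=1$, then $$n(e+1)-\frac{e(e-1)}2\le\sum_{k=1}^a\binom{m+k-1}{k}\qquad\text{and}\qquad am\le n(e+1)+e .$$ (ii) If $e\ge n$ or $b\ge2$, then $$\frac{n(n+3)}2\le\sum_{k=1}^a\binom{m+k-1}{k}.$$ -/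

import Mathlib

noncomputable section

open scoped BigOperators

/-- Affine coordinate space `ℂ^N ⊂ ℂℙ^N`, with its Euclidean norm. The point with affine
coordinate `z` is `[1 : z]`. -/
abbrev AffChart (N : ℕ) : Type := EuclideanSpace ℂ (Fin N)

/-- The `(0,1)`-part `∂̄u` of the differential of `u`, i.e. the real linear map
`v ↦ (du(v) + i du(iv)) / 2`. -/
def dbar {N : ℕ} (u : AffChart N → ℂ) (z : AffChart N) : AffChart N →L[ℝ] ℂ :=
  (1 / 2 : ℂ) • (fderiv ℝ u z +
    Complex.I • (fderiv ℝ u z).comp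
      ((Complex.I • ContinuousLinearMap.id ℂ (AffChart N)).restrictScalars ℝ))

/-- The complex-valued `2`-form `∂∂̄u`. It is computed as `d(∂̄u)`, which agrees with `∂(∂̄u)`
for `u` of class `C²` because `∂̄∂̄u = 0`. -/
def ddbar {N : ℕ} (u : AffChart N → ℂ) (z : AffChart N) : AffChart N [⋀^Fin 2]→L[ℝ] ℂ :=
  extDeriv (fun w => ContinuousAlternatingMap.ofSubsingleton ℝ (AffChart N) ℂ (0 : Fin 1)
    (dbar u w)) z

/-- The Fubini–Study form `ω_N = (√-1 / 2π) ∂∂̄ log (1 + ‖z‖²)` in the affine chart. -/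
def fubiniStudy (N : ℕ) (z : AffChart N) : AffChart N [⋀^Fin 2]→L[ℝ] ℂ :=
  (Complex.I / (2 * (Real.pi : ℂ))) •
    ddbar (fun w : AffChart N => ((Real.log (1 + ‖w‖ ^ 2) : ℝ) : ℂ)) z

/-- The pullback `φ^*ω` of a `2`-form. -/
def pullbackForm {n N : ℕ} (φ : AffChart n → AffChart N)
    (ω : AffChart N → AffChart N [⋀^Fin 2]→L[ℝ] ℂ) (z : AffChart n) :
    AffChart n [⋀^Fin 2]→L[ℝ] ℂ :=
  (ω (φ z)).compContinuousLinearMap (fderiv ℝ φ z)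

/-- `φ : Ω → ℂ^N ⊂ ℂℙ^N` is minimally embedded: its image lies in no proper projective plane;
in the affine chart, its image lies in no proper complex affine subspace of `ℂ^N`. -/
def MinimallyEmbedded {n N : ℕ} (Ω : Set (AffChart n)) (φ : AffChart n → AffChart N) : Prop :=
  ∀ P : AffineSubspace ℂ (AffChart N), φ '' Ω ⊆ P → P = ⊤

/-- The mapping `(1, φ)`, with values in `ℂ^{N+1}`. -/
def consOne {n N : ℕ} (φ : AffChart n → AffChart N) : AffChart n → Fin (N + 1) → ℂ :=
  fun z => Fin.cons 1 (fun i => φ z i)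

/-- The `k`-th tensor power `ψ^{⊗k}`: its components are all the products
`ψ_{J 1} ⋯ ψ_{J k}`, indexed by the multi-indices `J`. -/
def tensorPower {n : ℕ} {ι : Type} (ψ : AffChart n → ι → ℂ) (k : ℕ) :
    AffChart n → (Fin k → ι) → ℂ :=
  fun z J => ∏ i, ψ z (J i)

/-- The rank of `ψ` on `Ω`: the dimension of the complex vector space of functions on `Ω`
spanned by the components of `ψ` (equivalently, of the smallest linear subspace containing
`ψ(Ω)`). -/
def componentRank {n : ℕ} {ι : Type} (Ω : Set (AffChart n)) (ψ : AffChart n → ι → ℂ) : ℕ :=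
  Module.finrank ℂ (Submodule.span ℂ (Set.range fun (j : ι) (z : Ω) => ψ z j))

end

/-! On a ball, the relation between the forms says that `b log(1+‖z‖²) + c log(1+‖f‖²) - a
log(1+‖h‖²)` is killed by `∂∂̄`, so it is the real part of a holomorphic `G`. Exponentiating,
`(1,z)^{⊗b} ⊗ (1,f)^{⊗c}` and `e^{G/2} (1,h)^{⊗a}` have the same square norm, and by polarization
their components span the same space on a smaller ball. Writing `Z`, `F`, `H` for the spans of the
components of `(1,z)`, `(1,f)`, `(1,h)`, this gives `dim Z^b F^c = dim H^a`
(`rankOn_mul_eq_rankOn_pow`). By the identity theorem the dimensions on the ball are those on `Ω`,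
and minimality gives `dim F = d+1` and `dim H = m+1`.

All inequalities then come from bounding dimensions of products. From above, one counts monomials
(`componentRank_tensorPower_le`) or uses `dim VW ≤ dim V · dim W`. From below, one restricts to a
curve through the centre: a space of dimension `r` realises `r` vanishing orders, orders add under
multiplication, and functions of distinct orders are independent, so `dim VW` is at least the size
of a sumset in `ℕ`. Cauchy–Davenport gives `dim V^c ≥ c(dim V - 1) + 1`
(`mul_add_one_le_rankOn_pow`).

For products with `Z` a stronger bound is needed. The curve `t ↦ p + (t^{N_i})` has weights such
that `0, N_1, …, N_n`, the orders of `1` and of the centred coordinates, form a Sidon set. Its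
translates meet pairwise in at most one point, whence `dim ZV ≥ (n+1) + n + (n-1) + …`, with as many
terms as orders of `V` are used (`sum_le_rankOn_affine_mul`). Large weights also keep `V`
nondegenerate on the curve (`exists_nondegenerate_curve`). -/

noncomputable section

/-! ### Holomorphic functions of several variables: Cauchy estimates and smoothness -/

open Filter Topology in
/-- Cauchy's estimate for the Fréchet derivative. -/
theorem norm_fderiv_le_of_ball {E : Type*} [NormedAddCommGroup E] [NormedSpace ℂ E]
    {f : E → ℂ} {x : E} {R M : ℝ} (hR : 0 < R) (hf : DifferentiableOn ℂ f (Metric.ball x R))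
    (hM : ∀ y ∈ Metric.ball x R, ‖f y‖ ≤ M) : ‖fderiv ℂ f x‖ ≤ M / (R / 2) := by
  have hx : x ∈ Metric.ball x R := Metric.mem_ball_self hR
  have hM0 : 0 ≤ M := (norm_nonneg _).trans (hM x hx)
  refine ContinuousLinearMap.opNorm_le_bound _ (by positivity) fun v => ?_
  rcases eq_or_ne v 0 with rfl | hv
  · simp
  have hv' : 0 < ‖v‖ := norm_pos_iff.2 hv
  have hfx : DifferentiableAt ℂ f (x + (0 : ℂ) • v) := by
    simpa using hf.differentiableAt (Metric.isOpen_ball.mem_nhds hx)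
  have hd := hfx.deriv_comp_add_smul (y := v)
  rw [zero_smul, add_zero] at hd
  rw [← hd]
  -- Half the radius keeps the closed disc in direction `v` inside the open ball, at the price of a
  -- factor 2.
  have hmaps : ∀ s ∈ Metric.closedBall (0 : ℂ) (R / 2 / ‖v‖), x + s • v ∈ Metric.ball x R := by
    intro s hs
    rw [mem_closedBall_zero_iff, le_div_iff₀ hv'] at hs
    rw [mem_ball_iff_norm, add_sub_cancel_left, norm_smul]
    linarith
  have hρ : 0 < R / 2 / ‖v‖ := by positivity
  have key := Complex.norm_deriv_le_of_forall_mem_sphere_norm_le (c := (0 : ℂ)) (C := M) hρ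
    (f := fun s : ℂ => f (x + s • v)) ?_ ?_
  · refine key.trans (le_of_eq ?_)
    field_simp
  · refine DifferentiableOn.diffContOnCl ?_
    rw [closure_ball _ hρ.ne']
    exact hf.comp (by fun_prop) hmaps
  · exact fun s hs => hM _ (hmaps s (Metric.sphere_subset_closedBall hs))

open Filter Topology MeasureTheory in
/-- Integrals of a holomorphic function composed with a continuous family of homotheties are
holomorphic. -/
theorem differentiableAt_intervalIntegral_comp_smul_add {E : Type*} [NormedAddCommGroup E]
    [NormedSpace ℂ E] [FiniteDimensional ℂ E] {U : Set E} (hU : IsOpen U) {f : E → ℂ}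
    (hf : DifferentiableOn ℂ f U) {α β : ℝ} {a c : ℝ → ℂ} {b : ℝ → E} (ha : Continuous a)
    (hb : Continuous b) (hc : Continuous c) {x₀ : E} {ρ R M : ℝ} (hρ : 0 < ρ) (hR : 0 < R)
    (hball : ∀ t, ∀ x ∈ Metric.ball x₀ ρ, t ∈ Set.uIcc α β → ∀ y ∈ Metric.ball (a t • x + b t) R,
      y ∈ U ∧ ‖f y‖ ≤ M) :
    DifferentiableAt ℂ (fun x => ∫ t in α..β, c t * f (a t • x + b t)) x₀ := by
  let _ : MeasurableSpace E := borel E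
  have _ : BorelSpace E := ⟨rfl⟩
  have _ : CompleteSpace E := FiniteDimensional.complete ℂ E
  have _ : SecondCountableTopology (E →L[ℂ] ℂ) := by
    have _ : ProperSpace (E →L[ℂ] ℂ) := FiniteDimensional.proper ℂ _
    infer_instance
  have hmem : ∀ t ∈ Set.uIcc α β, ∀ x ∈ Metric.ball x₀ ρ, a t • x + b t ∈ U := fun t ht x hx =>
    (hball t x hx ht _ (Metric.mem_ball_self hR)).1
  have hcont : ∀ x ∈ Metric.ball x₀ ρ,
      ContinuousOn (fun t => c t * f (a t • x + b t)) (Set.uIcc α β) := fun x hx =>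
    hc.continuousOn.mul (hf.continuousOn.comp (by fun_prop) fun t ht => hmem t ht x hx)
  have hint : ∀ x ∈ Metric.ball x₀ ρ,
      IntervalIntegrable (fun t => c t * f (a t • x + b t)) volume α β := fun x hx =>
    (hcont x hx).intervalIntegrable
  refine (intervalIntegral.hasFDerivAt_integral_of_dominated_of_fderiv_le (𝕜 := ℂ)
    (F := fun x t => c t * f (a t • x + b t))
    (F' := fun x t => (c t * a t) • fderiv ℂ f (a t • x + b t))
    (bound := fun t => ‖c t * a t‖ * (M / (R / 2))) (Metric.ball_mem_nhds x₀ hρ)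
    ?_ (hint x₀ (Metric.mem_ball_self hρ)) ?_ ?_ ?_ ?_).differentiableAt
  · filter_upwards [Metric.ball_mem_nhds x₀ hρ] with x hx
    exact ((intervalIntegrable_iff.1 (hint x hx))).aestronglyMeasurable
  · refine Measurable.aestronglyMeasurable ?_
    refine Measurable.smul (hc.mul ha).measurable ?_
    exact (measurable_fderiv ℂ f).comp (by fun_prop : Continuous _).measurable
  · refine ae_of_all _ fun t ht x hx => ?_
    rw [norm_smul]
    have hb' := hball t x hx (Set.uIoc_subset_uIcc ht)
    gcongr
    exact norm_fderiv_le_of_ball hR (hf.mono fun y hy => (hb' y hy).1) fun y hy => (hb' y hy).2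
  · exact (Continuous.mul (by fun_prop) continuous_const).intervalIntegrable _ _
  · refine ae_of_all _ fun t ht x hx => ?_
    have hfx : HasFDerivAt f (fderiv ℂ f (a t • x + b t)) (a t • x + b t) :=
      (hf.differentiableAt (hU.mem_nhds
        (hmem t (Set.uIoc_subset_uIcc ht) x hx))).hasFDerivAt
    have hlin : HasFDerivAt (fun x : E => a t • x + b t) (a t • ContinuousLinearMap.id ℂ E) x :=
      ((hasFDerivAt_id x).const_smul (a t)).add_const (b t)
    refine ((hfx.comp x hlin).const_smul (c t)).congr_fderiv ?_
    ext v
    simp [mul_assoc]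

open Filter Topology in
/-- Directional derivatives of holomorphic functions are holomorphic. -/
theorem DifferentiableOn.fderiv_apply_of_isOpen {E : Type*} [NormedAddCommGroup E]
    [NormedSpace ℂ E] [FiniteDimensional ℂ E] {U : Set E} (hU : IsOpen U) {f : E → ℂ}
    (hf : DifferentiableOn ℂ f U) (v : E) : DifferentiableOn ℂ (fun x => fderiv ℂ f x v) U := by
  intro x₀ hx₀
  refine DifferentiableAt.differentiableWithinAt ?_
  have hcx : ContinuousAt f x₀ := hf.continuousOn.continuousAt (hU.mem_nhds hx₀)
  have hev : ∀ᶠ y in 𝓝 x₀, y ∈ U ∧ ‖f y‖ ≤ ‖f x₀‖ + 1 :=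
    (hU.eventually_mem hx₀).and
      ((hcx.norm.eventually (gt_mem_nhds (lt_add_one _))).mono fun _ h => le_of_lt h)
  obtain ⟨ε, hε, hball⟩ := Metric.eventually_nhds_iff_ball.1 hev
  -- The radius `ε` is split in three: motion of the base point, displacement along the circle, and
  -- room for the Cauchy estimate under the integral.
  obtain ⟨s, hs, hsv⟩ : ∃ s : ℝ, 0 < s ∧ s * ‖v‖ < ε / 3 := by
    refine ⟨ε / 3 / (‖v‖ + 1), by positivity, ?_⟩
    have : 0 ≤ ‖v‖ := norm_nonneg v
    rw [div_mul_eq_mul_div, div_lt_iff₀ (by positivity)]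
    nlinarith
  have hcirc : ∀ θ : ℝ, ‖circleMap 0 s θ‖ = s := fun θ => by simp [abs_of_pos hs]
  have hne : ∀ θ : ℝ, circleMap 0 s θ ≠ 0 := fun θ => by
    rw [← norm_pos_iff, hcirc]; exact hs
  have hin : ∀ x ∈ Metric.ball x₀ (ε / 3), ∀ w : ℂ, ‖w‖ ≤ s → ∀ y ∈ Metric.ball (x + w • v) (ε / 3),
      y ∈ Metric.ball x₀ ε := by
    intro x hx w hw y hy
    rw [mem_ball_iff_norm] at *
    have h1 : ‖w • v‖ < ε / 3 := by
      rw [norm_smul]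
      exact (mul_le_mul_of_nonneg_right hw (norm_nonneg v)).trans_lt hsv
    have h2 : y - x₀ = (y - (x + w • v)) + ((x - x₀) + w • v) := by abel
    rw [h2]
    have h3 := norm_add_le (y - (x + w • v)) ((x - x₀) + w • v)
    have h4 := norm_add_le (x - x₀) (w • v)
    linarith
  -- The directional derivative is Cauchy's integral over `w ↦ f (x + w • v)`; the weight `c` is `dw
  -- / (2πi w²)` on the circle of radius `s`.
  have key := differentiableAt_intervalIntegral_comp_smul_add hU hf (α := 0) (β := 2 * Real.pi)
    (a := fun _ => 1) (b := fun θ => circleMap 0 s θ • v)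
    (c := fun θ => (2 * Real.pi * Complex.I)⁻¹ * ((circleMap 0 s θ * Complex.I) *
      ((circleMap 0 s θ) ^ 2)⁻¹)) continuous_const
    ((continuous_circleMap 0 s).smul continuous_const)
    (continuous_const.mul (((continuous_circleMap 0 s).mul continuous_const).mul
      (((continuous_circleMap 0 s).pow 2).inv₀ fun θ => pow_ne_zero 2 (hne θ))))
    (x₀ := x₀) (ρ := ε / 3) (R := ε / 3) (M := ‖f x₀‖ + 1) (by positivity) (by positivity)
    (fun θ x hx _ y hy => hball y (hin x hx _ (hcirc θ).le y (by simpa using hy)))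
  refine key.congr_of_eventuallyEq ?_
  filter_upwards [Metric.ball_mem_nhds x₀ (show 0 < ε / 3 by positivity)] with x hx
  have hxw : ∀ w ∈ Metric.closedBall (0 : ℂ) s, x + w • v ∈ U := fun w hw =>
    (hball _ (hin x hx w (by simpa using hw) _ (Metric.mem_ball_self (by positivity)))).1
  have hxU : DifferentiableAt ℂ f (x + (0 : ℂ) • v) :=
    hf.differentiableAt (hU.mem_nhds (hxw 0 (Metric.mem_closedBall_self hs.le)))
  have hd := hxU.deriv_comp_add_smul
  rw [zero_smul, add_zero] at hd
  have hO : IsOpen {w : ℂ | x + w • v ∈ U} := hU.preimage (by fun_prop)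
  have hC := Complex.two_pi_I_inv_smul_circleIntegral_sub_sq_inv_smul_of_differentiable
    (f := fun w : ℂ => f (x + w • v)) hO hxw (hf.comp (by fun_prop) fun w hw => hw)
    (Metric.mem_ball_self hs)
  rw [← hd, ← hC, circleIntegral, smul_eq_mul, ← intervalIntegral.integral_const_mul]
  refine intervalIntegral.integral_congr fun θ _ => ?_
  simp only [deriv_circleMap, smul_eq_mul, sub_zero, one_smul]
  ring

/-- A holomorphic function on an open subset of a finite-dimensional space is smooth. -/
theorem DifferentiableOn.contDiffOn_nat {E : Type*} [NormedAddCommGroup E]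
    [NormedSpace ℂ E] [FiniteDimensional ℂ E] {U : Set E} (hU : IsOpen U) (k : ℕ) {f : E → ℂ}
    (hf : DifferentiableOn ℂ f U) : ContDiffOn ℂ k f U := by
  induction k generalizing f with
  | zero => exact contDiffOn_zero.2 hf.continuousOn
  | succ k ih =>
    rw [Nat.cast_succ, contDiffOn_succ_iff_fderiv_of_isOpen hU]
    exact ⟨hf, by simp, contDiffOn_clm_apply.2 fun v => ih (hf.fderiv_apply_of_isOpen hU v)⟩

open Filter Topology Asymptotics in
/-- An analytic function that is `O(s ^ k)` vanishes to order at least `k`. -/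
theorem AnalyticAt.natCast_le_analyticOrderAt_of_isBigO {u : ℂ → ℂ} (hu : AnalyticAt ℂ u 0) {k : ℕ}
    (hO : u =O[𝓝 0] fun s => ‖s‖ ^ k) : (k : ℕ∞) ≤ analyticOrderAt u 0 := by
  by_contra! hlt
  obtain ⟨j, hj⟩ := ENat.ne_top_iff_exists.1 hlt.ne_top
  rw [← hj] at hlt
  have hjk : j < k := by exact_mod_cast hlt
  obtain ⟨g, hg, hg0, hgu⟩ := hu.analyticOrderAt_eq_natCast.1 hj.symm
  obtain ⟨C, hC⟩ := hO.bound
  have h1 : Tendsto (fun s : ℂ => ‖g s‖) (𝓝[≠] 0) (𝓝 ‖g 0‖) :=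
    (hg.continuousAt.norm.tendsto).mono_left nhdsWithin_le_nhds
  have h2 : Tendsto (fun s : ℂ => C * ‖s‖ ^ (k - j)) (𝓝[≠] 0) (𝓝 0) := by
    have : Tendsto (fun s : ℂ => C * ‖s‖ ^ (k - j)) (𝓝 0) (𝓝 (C * ‖(0 : ℂ)‖ ^ (k - j))) :=
      Continuous.tendsto (by fun_prop) 0
    rw [norm_zero, zero_pow (by omega), mul_zero] at this
    exact this.mono_left nhdsWithin_le_nhds
  have h3 : ‖g 0‖ ≤ 0 := by
    refine le_of_tendsto_of_tendsto h1 h2 ?_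
    filter_upwards [self_mem_nhdsWithin, hgu.filter_mono nhdsWithin_le_nhds,
      hC.filter_mono nhdsWithin_le_nhds] with s hs hgs hCs
    have hs' : 0 < ‖s‖ := norm_pos_iff.2 hs
    rw [hgs, sub_zero, norm_smul, norm_pow, norm_pow, norm_norm,
      ← Nat.add_sub_of_le hjk.le, pow_add] at hCs
    have hpos : 0 < ‖s‖ ^ j := by positivity
    rw [show C * (‖s‖ ^ j * ‖s‖ ^ (k - j)) = ‖s‖ ^ j * (C * ‖s‖ ^ (k - j)) by ring] at hCs
    exact le_of_mul_le_mul_left hCs hpos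
  exact hg0 (norm_le_zero_iff.1 h3)

/-! ### Identity theorems by restriction to complex lines -/

section Lines

variable {E : Type*} [NormedAddCommGroup E] [NormedSpace ℂ E] {U : Set E} {f : E → ℂ}

open Filter Topology

/-- The restriction of a holomorphic function to a complex line is analytic. -/
theorem DifferentiableOn.analyticAt_line (hU : IsOpen U) (hf : DifferentiableOn ℂ f U) (w v : E)
    {s : ℂ} (hs : w + s • v ∈ U) : AnalyticAt ℂ (fun s : ℂ => f (w + s • v)) s := by
  have hO : IsOpen {s : ℂ | w + s • v ∈ U} := hU.preimage (by fun_prop)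
  exact DifferentiableOn.analyticAt (s := {s : ℂ | w + s • v ∈ U})
    (hf.comp (by fun_prop) fun s hs => hs) (hO.mem_nhds hs)

/-- Identity theorem along a complex line in a convex open set. -/
theorem DifferentiableOn.eq_zero_of_eventually_line (hU : IsOpen U) (hc : Convex ℝ U)
    (hf : DifferentiableOn ℂ f U) {w y : E} (hw : w ∈ U) (hy : y ∈ U)
    (h0 : ∀ᶠ s in 𝓝 (0 : ℂ), f (w + s • (y - w)) = 0) : f y = 0 := by
  have hconv : Convex ℝ {s : ℂ | w + s • (y - w) ∈ U} := by
    intro s hs t ht a b ha hb hab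
    have := hc hs ht ha hb hab
    simp only [Set.mem_ofPred_eq]
    convert this using 1
    have hw' : w = a • w + b • w := by rw [← add_smul, hab, one_smul]
    nth_rewrite 1 [hw']
    simp only [smul_add, add_smul, smul_assoc]
    abel
  have han : AnalyticOnNhd ℂ (fun s : ℂ => f (w + s • (y - w))) {s : ℂ | w + s • (y - w) ∈ U} :=
    fun s hs => hf.analyticAt_line hU w _ hs
  have := han.eqOn_zero_of_preconnected_of_eventuallyEq_zero hconv.isPreconnected
    (z₀ := 0) (by simpa using hw) h0 (show (1 : ℂ) ∈ _ by simpa using hy)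
  simpa using this

/-- Identity theorem for holomorphic functions on an open preconnected set. -/
theorem DifferentiableOn.eqOn_zero_of_isPreconnected (hU : IsOpen U) (hc : IsPreconnected U)
    (hf : DifferentiableOn ℂ f U) {p : E} (hp : p ∈ U) (h0 : f =ᶠ[𝓝 p] 0) : Set.EqOn f 0 U := by
  have hopen : IsOpen {z : E | f =ᶠ[𝓝 z] 0} := isOpen_setOfPred_eventually_nhds
  -- The set of points near which `f` vanishes is open. It is also closed in `U`: a ball around a
  -- limit point contains a point `w` of it, and the line from `w` reaches every point of the ball.
  have hsub : U ⊆ {z : E | f =ᶠ[𝓝 z] 0} := by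
    refine hc.subset_of_closure_inter_subset hopen ⟨p, hp, h0⟩ ?_
    rintro z ⟨hz, hzU⟩
    obtain ⟨ε, hε, hball⟩ := Metric.isOpen_iff.1 hU z hzU
    obtain ⟨w, hw, hwz⟩ := Metric.mem_closure_iff.1 hz ε hε
    have hwB : w ∈ Metric.ball z ε := by rwa [Metric.mem_ball']
    filter_upwards [Metric.ball_mem_nhds z hε] with y hy
    refine (hf.mono hball).eq_zero_of_eventually_line Metric.isOpen_ball
      (convex_ball z ε) hwB hy ?_
    have ht : Tendsto (fun s : ℂ => w + s • (y - w)) (𝓝 0) (𝓝 w) := by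
      have : Continuous fun s : ℂ => w + s • (y - w) := by fun_prop
      simpa using this.tendsto 0
    exact ht.eventually hw
  exact fun z hz => (hsub hz).self_of_nhds

/-- A holomorphic function on a ball that is flat at the centre is zero. -/
theorem DifferentiableOn.eqOn_zero_of_flat {p : E} {R : ℝ}
    (hf : DifferentiableOn ℂ f (Metric.ball p R))
    (hO : ∀ k : ℕ, f =O[𝓝 p] fun y => ‖y - p‖ ^ k) : Set.EqOn f 0 (Metric.ball p R) := by
  intro y hy
  have hp : p ∈ Metric.ball p R := Metric.mem_ball_self (Metric.pos_of_mem_ball hy)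
  refine hf.eq_zero_of_eventually_line Metric.isOpen_ball (convex_ball p R) hp hy ?_
  have han := hf.analyticAt_line Metric.isOpen_ball p (y - p) (s := 0) (by simpa using hp)
  rw [← analyticOrderAt_eq_top]
  refine ENat.eq_top_iff_forall_ge.2 fun k => han.natCast_le_analyticOrderAt_of_isBigO ?_
  have ht : Tendsto (fun s : ℂ => p + s • (y - p)) (𝓝 0) (𝓝 p) := by
    have : Continuous fun s : ℂ => p + s • (y - p) := by fun_prop
    simpa using this.tendsto 0
  refine ((hO k).comp_tendsto ht).trans ?_
  refine Asymptotics.IsBigO.of_bound (‖y - p‖ ^ k) (Eventually.of_forall fun s => ?_)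
  simp [norm_smul, mul_pow, mul_comm]

end Lines

/-! ### Hadamard's lemma and Taylor polynomials -/

open Filter Topology in
/-- **Hadamard's lemma** for holomorphic functions on a ball. -/
theorem DifferentiableOn.exists_hadamard {n : ℕ} {p : AffChart n} {R : ℝ} {f : AffChart n → ℂ}
    (hf : DifferentiableOn ℂ f (Metric.ball p R)) :
    ∃ g : Fin n → AffChart n → ℂ, (∀ i, DifferentiableOn ℂ (g i) (Metric.ball p R)) ∧
      ∀ y ∈ Metric.ball p R, f y = f p + ∑ i, (y i - p i) * g i y := by
  set e : Fin n → AffChart n := fun i => EuclideanSpace.single i (1 : ℂ) with he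
  have hD : ∀ i, DifferentiableOn ℂ (fun x => fderiv ℂ f x (e i)) (Metric.ball p R) := fun i =>
    hf.fderiv_apply_of_isOpen Metric.isOpen_ball (e i)
  have hseg : ∀ {r : ℝ}, ∀ x ∈ Metric.ball p r, ∀ t ∈ Set.uIcc (0 : ℝ) 1,
      (t : ℂ) • x + ((1 - t : ℝ) : ℂ) • p ∈ Metric.ball p r := by
    intro r x hx t ht
    rw [Set.uIcc_of_le zero_le_one] at ht
    have := convex_ball p r hx (Metric.mem_ball_self (Metric.pos_of_mem_ball hx)) ht.1
      (sub_nonneg.2 ht.2) (by ring)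
    simpa only [Complex.coe_smul] using this
  -- The integral of `∂ᵢf` along the segment from `p` to `x`; the factor `1` is the trivial weight
  -- of the integral lemma.
  refine ⟨fun i x => ∫ t in (0 : ℝ)..1, 1 * fderiv ℂ f ((t : ℂ) • x + ((1 - t : ℝ) : ℂ) • p) (e i),
    fun i x₀ hx₀ => DifferentiableAt.differentiableWithinAt ?_, fun y hy => ?_⟩
  · obtain ⟨R₁, h1, h2⟩ := exists_between (Metric.mem_ball.1 hx₀)
    obtain ⟨R₂, h3, h4⟩ := exists_between h2
    have hsub : Metric.closedBall p R₂ ⊆ Metric.ball p R := Metric.closedBall_subset_ball h4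
    obtain ⟨M, hM⟩ := (isCompact_closedBall p R₂).exists_bound_of_continuousOn
      ((hD i).continuousOn.mono hsub)
    refine differentiableAt_intervalIntegral_comp_smul_add Metric.isOpen_ball (hD i)
      (a := fun t => (t : ℂ)) (c := fun _ => 1) (b := fun t => ((1 - t : ℝ) : ℂ) • p) (by fun_prop)
      (by fun_prop) (by fun_prop) (ρ := R₁ - Dist.dist x₀ p) (R := R₂ - R₁) (M := M) (by linarith)
      (by linarith) fun t x hx ht z hz => ?_
    have hxp : x ∈ Metric.ball p R₁ := by
      rw [Metric.mem_ball] at *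
      linarith [dist_triangle x x₀ p]
    have hz' : z ∈ Metric.closedBall p R₂ := by
      have h5 := hseg x hxp t ht
      rw [Metric.mem_ball] at h5 hz
      rw [Metric.mem_closedBall]
      linarith [dist_triangle z ((t : ℂ) • x + ((1 - t : ℝ) : ℂ) • p) p]
    exact ⟨hsub hz', hM z hz'⟩
  · have hline : ∀ t : ℝ, (t : ℂ) • y + ((1 - t : ℝ) : ℂ) • p = p + (t : ℂ) • (y - p) := by
      intro t
      push_cast
      module
    have hmem : ∀ t ∈ Set.uIcc (0 : ℝ) 1, p + (t : ℂ) • (y - p) ∈ Metric.ball p R := fun t ht => by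
      rw [← hline]; exact hseg y hy t ht
    have hcont : ∀ i, ContinuousOn (fun t : ℝ => fderiv ℂ f (p + (t : ℂ) • (y - p)) (e i))
        (Set.uIcc 0 1) := fun i => (hD i).continuousOn.comp (by fun_prop) hmem
    have hderiv : ∀ t ∈ Set.uIcc (0 : ℝ) 1,
        HasDerivAt (fun t : ℝ => f (p + (t : ℂ) • (y - p)))
          (∑ i, (y i - p i) * fderiv ℂ f (p + (t : ℂ) • (y - p)) (e i)) t := by
      intro t ht
      have hft := hf.differentiableAt (Metric.isOpen_ball.mem_nhds (hmem t ht))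
      have h1 : HasDerivAt (fun s : ℂ => p + s • (y - p)) (y - p) (t : ℂ) := by
        simpa using ((hasDerivAt_id (t : ℂ)).smul_const (y - p)).const_add p
      have h2 := (hft.hasFDerivAt.comp_hasDerivAt (t : ℂ) h1).comp_ofReal
      refine h2.congr_deriv ?_
      have hy' : y - p = ∑ i, (y i - p i) • e i := by
        ext j
        simp [he, Pi.single_apply]
      conv_lhs => rw [hy']
      rw [map_sum]
      refine Finset.sum_congr rfl fun i _ => ?_
      rw [map_smul, smul_eq_mul, ← hy']
    have hint := intervalIntegral.integral_eq_sub_of_hasDerivAt hderiv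
      (ContinuousOn.intervalIntegrable (continuousOn_finsetSum _ fun i _ =>
        continuousOn_const.mul (hcont i)))
    rw [intervalIntegral.integral_finsetSum fun i _ =>
      ((hcont i).const_mul (y i - p i)).intervalIntegrable] at hint
    simp only [intervalIntegral.integral_const_mul] at hint
    simp only [hline, one_mul]
    rw [hint]
    simp

open Filter Topology Asymptotics in
/-- Taylor approximation of a holomorphic function by polynomials. -/
theorem DifferentiableOn.exists_mvPolynomial_isBigO {n : ℕ} {p : AffChart n} {R : ℝ} (hR : 0 < R)
    (k : ℕ) {f : AffChart n → ℂ} (hf : DifferentiableOn ℂ f (Metric.ball p R)) :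
    ∃ P : MvPolynomial (Fin n) ℂ, P.totalDegree ≤ k ∧
      (fun y => f y - MvPolynomial.eval (fun i => y i - p i) P) =O[𝓝 p]
        fun y => ‖y - p‖ ^ (k + 1) := by
  induction k generalizing f with
  | zero =>
    refine ⟨MvPolynomial.C (f p), by simp, ?_⟩
    have hfp := hf.differentiableAt (Metric.ball_mem_nhds p hR)
    simpa using hfp.isBigO_sub.norm_right
  | succ k ih =>
    obtain ⟨g, hg, hfg⟩ := hf.exists_hadamard
    choose P hP hPO using fun i => ih (hg i)
    refine ⟨MvPolynomial.C (f p) + ∑ i, MvPolynomial.X i * P i, ?_, ?_⟩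
    · refine (MvPolynomial.totalDegree_add _ _).trans (max_le (by simp) ?_)
      refine MvPolynomial.totalDegree_finsetSum_le fun i _ => ?_
      refine (MvPolynomial.totalDegree_mul _ _).trans ?_
      rw [MvPolynomial.totalDegree_X]
      linarith [hP i]
    · have heq : (fun y => f y - MvPolynomial.eval (fun i => y i - p i)
            (MvPolynomial.C (f p) + ∑ i, MvPolynomial.X i * P i)) =ᶠ[𝓝 p]
          fun y => ∑ i, (y i - p i) *
            (g i y - MvPolynomial.eval (fun i => y i - p i) (P i)) := by
        filter_upwards [Metric.ball_mem_nhds p hR] with y hy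
        rw [hfg y hy]
        simp [mul_sub, map_sum]
      refine heq.trans_isBigO (IsBigO.fun_sum fun i _ => ?_)
      have h1 : (fun y : AffChart n => y i - p i) =O[𝓝 p] fun y => ‖y - p‖ := by
        refine IsBigO.of_bound 1 (Eventually.of_forall fun y => ?_)
        simpa using PiLp.norm_apply_le (y - p) i
      refine (h1.mul (hPO i)).congr_right fun y => ?_
      ring

/-! ### Vanishing orders and linear independence in one variable -/

section Orders

open Filter Topology

theorem iteratedDeriv_sum_const_mul {J : Type*} (S : Finset J) {w : J → ℂ → ℂ}
    (hw : ∀ j ∈ S, AnalyticAt ℂ (w j) 0) (c : J → ℂ) (k : ℕ) :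
    iteratedDeriv k (fun s => ∑ j ∈ S, c j * w j s) 0 = ∑ j ∈ S, c j * iteratedDeriv k (w j) 0 := by
  rw [iteratedDeriv_fun_sum (f := fun j s => c j * w j s) fun j hj =>
    (analyticAt_const.mul (hw j hj)).contDiffAt]
  exact Finset.sum_congr rfl fun j _ => iteratedDeriv_const_mul_field _ _

/-- Analytic functions with distinct finite vanishing orders are linearly independent, as seen by
derivatives at the base point. -/
theorem eq_zero_of_iteratedDeriv_sum_eq_zero {J : Type*} (S : Finset J) {w : J → ℂ → ℂ}
    (hw : ∀ j ∈ S, AnalyticAt ℂ (w j) 0) {o : J → ℕ} (ho : Set.InjOn o S)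
    (how : ∀ j ∈ S, analyticOrderAt (w j) 0 = o j) (c : J → ℂ)
    (h : ∀ j ∈ S, iteratedDeriv (o j) (fun s => ∑ j ∈ S, c j * w j s) 0 = 0) :
    ∀ j ∈ S, c j = 0 := by
  -- Induction on the order: in the derivative of order `N`, terms of lower order already have zero
  -- coefficient, and terms of higher order do not contribute.
  suffices H : ∀ N : ℕ, ∀ j ∈ S, o j = N → c j = 0 from fun j hj => H _ j hj rfl
  intro N
  induction N using Nat.strong_induction_on with
  | _ N ih =>
    intro j hj hjN
    have hj0 := h j hj
    rw [iteratedDeriv_sum_const_mul S hw, Finset.sum_eq_single j] at hj0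
    · have := ((analyticOrderAt_eq_nat_iff_iteratedDeriv_eq_zero (hw j hj)).1 (how j hj)).2
      exact (mul_eq_zero.1 hj0).resolve_right this
    · intro i hi hij
      rcases lt_or_gt_of_ne (fun h => hij (ho hi hj h) : o i ≠ o j) with hlt | hgt
      · rw [ih (o i) (hjN ▸ hlt) i hi rfl, zero_mul]
      · rw [((analyticOrderAt_eq_nat_iff_iteratedDeriv_eq_zero (hw i hi)).1 (how i hi)).1 _ hgt,
          mul_zero]
    · exact fun h => absurd hj h

/-- A space of germs of dimension `r` realises at least `r` different vanishing orders. -/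
theorem exists_finset_analyticOrderAt {J : Type*} [Fintype J] {u : J → ℂ → ℂ}
    (hu : ∀ j, AnalyticAt ℂ (u j) 0)
    (hnd : ∀ c : J → ℂ, (∀ᶠ s in 𝓝 (0 : ℂ), ∑ j, c j * u j s = 0) → c = 0) :
    ∃ A : Finset ℕ, A.card = Fintype.card J ∧
      ∀ a ∈ A, ∃ c : J → ℂ, analyticOrderAt (fun s => ∑ j, c j * u j s) 0 = a := by
  set A₀ : Set ℕ := {a | ∃ c : J → ℂ, analyticOrderAt (fun s => ∑ j, c j * u j s) 0 = a} with hA₀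
  have han : ∀ c : J → ℂ, AnalyticAt ℂ (fun s => ∑ j, c j * u j s) 0 := fun c =>
    Finset.analyticAt_fun_sum _ fun j _ => analyticAt_const.mul (hu j)
  by_cases hfin : A₀.Finite
  · by_cases hcard : Fintype.card J ≤ hfin.toFinset.card
    · obtain ⟨A, hA, hAc⟩ := Finset.exists_subset_card_eq hcard
      exact ⟨A, hAc, fun a ha => by simpa [hA₀] using hA ha⟩
    exfalso
    push Not at hcard
    -- With fewer realised orders than functions, some nonzero combination has zero derivative at
    -- every realised order, including its own order, which is absurd.
    let L : (J → ℂ) →ₗ[ℂ] (hfin.toFinset → ℂ) :=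
      { toFun := fun c a => ∑ j, c j * iteratedDeriv (a : ℕ) (u j) 0
        map_add' := fun c c' => by ext a; simp [add_mul, Finset.sum_add_distrib]
        map_smul' := fun t c => by ext a; simp [Finset.mul_sum, mul_assoc] }
    have hker : LinearMap.ker L ≠ ⊥ := LinearMap.ker_ne_bot_of_finrank_lt (by simpa using hcard)
    obtain ⟨c, hc, hc0⟩ := (Submodule.ne_bot_iff _).1 hker
    have hne : analyticOrderAt (fun s => ∑ j, c j * u j s) 0 ≠ ⊤ := fun htop =>
      hc0 (hnd c (analyticOrderAt_eq_top.1 htop))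
    obtain ⟨a, ha⟩ := ENat.ne_top_iff_exists.1 hne
    have haA : a ∈ hfin.toFinset := by simpa [hA₀] using ⟨c, ha.symm⟩
    have h1 := ((analyticOrderAt_eq_nat_iff_iteratedDeriv_eq_zero (han c)).1 ha.symm).2
    rw [iteratedDeriv_sum_const_mul _ fun j _ => hu j] at h1
    exact h1 (congrFun (LinearMap.mem_ker.1 hc) ⟨a, haA⟩)
  · obtain ⟨A, hA, hAc⟩ := Set.Infinite.exists_subset_card_eq hfin (Fintype.card J)
    exact ⟨A, hAc, fun a ha => hA ha⟩

end Orders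

/-! ### Weights separating monomials of bounded degree -/

section Weights

/-- Weights for which monomials of degree at most `k` in `n` variables have different weights, all
smaller than the weights of monomials of higher degree. -/
def curveWeight (n k : ℕ) (i : Fin n) : ℕ := (k + 1) ^ n + (k + 1) ^ (i : ℕ)

theorem sum_mul_curveWeight {n k : ℕ} (α : Fin n → ℕ) : ∑ i, α i * curveWeight n k i =
    (k + 1) ^ n * ∑ i, α i + ∑ i, α i * (k + 1) ^ (i : ℕ) := by
  simp only [curveWeight, mul_add, Finset.sum_add_distrib, Finset.mul_sum]
  congr 1
  exact Finset.sum_congr rfl fun i _ => mul_comm _ _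

theorem sum_digits_lt {n k : ℕ} {α : Fin n → ℕ} (hα : ∑ i, α i ≤ k) :
    ∑ i, α i * (k + 1) ^ (i : ℕ) < (k + 1) ^ n := by
  have hlt : ∀ i, α i < k + 1 := fun i => Nat.lt_succ_of_le
    ((Finset.single_le_sum (fun _ _ => Nat.zero_le _) (Finset.mem_univ i)).trans hα)
  have := (finFunctionFinEquiv fun i => (⟨α i, hlt i⟩ : Fin (k + 1))).2
  rwa [finFunctionFinEquiv_apply] at this

/-- Modulo `(k + 1) ^ n` only `∑ αᵢ (k + 1)ⁱ` remains, and its base-`(k + 1)` digits are the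
exponents. -/
theorem sum_mul_curveWeight_injective {n k : ℕ} {α β : Fin n → ℕ} (hα : ∑ i, α i ≤ k)
    (hβ : ∑ i, β i ≤ k)
    (h : ∑ i, α i * curveWeight n k i = ∑ i, β i * curveWeight n k i) : α = β := by
  rw [sum_mul_curveWeight, sum_mul_curveWeight] at h
  have h' := congrArg (· % (k + 1) ^ n) h
  simp only [Nat.mul_add_mod, Nat.mod_eq_of_lt (sum_digits_lt hα),
    Nat.mod_eq_of_lt (sum_digits_lt hβ)] at h'
  have hlt : ∀ {γ : Fin n → ℕ}, ∑ i, γ i ≤ k → ∀ i, γ i < k + 1 := fun hγ i => Nat.lt_succ_of_le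
    ((Finset.single_le_sum (fun _ _ => Nat.zero_le _) (Finset.mem_univ i)).trans hγ)
  have hinj := finFunctionFinEquiv.injective (Fin.ext
    (a := finFunctionFinEquiv fun i => (⟨α i, hlt hα i⟩ : Fin (k + 1)))
    (b := finFunctionFinEquiv fun i => (⟨β i, hlt hβ i⟩ : Fin (k + 1)))
    (by rw [finFunctionFinEquiv_apply, finFunctionFinEquiv_apply]; exact h'))
  funext i
  exact congrArg Fin.val (congrFun hinj i)

/-- The right-hand side is the order that the Taylor remainder of degree `k` is known to have along
the curve, so it cannot interfere with these monomials. -/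
theorem sum_mul_curveWeight_lt {n k : ℕ} {α : Fin n → ℕ} (hα : ∑ i, α i ≤ k) :
    ∑ i, α i * curveWeight n k i < (k + 1) ^ n * (k + 1) := by
  rw [sum_mul_curveWeight, mul_add, mul_one]
  exact add_lt_add_of_le_of_lt (Nat.mul_le_mul_left _ hα) (sum_digits_lt hα)

/-- A pair of indices is a quadratic monomial in `n + 1` homogeneous variables, index `0` having
weight zero. Monomials of degree at most 2 have distinct weights, which is where `2 ≤ k` enters. -/
theorem curveWeight_sidon {n k : ℕ} (hk : 2 ≤ k) {x y x' y' : Fin (n + 1)}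
    (h : (Fin.cons 0 (curveWeight n k) : Fin (n + 1) → ℕ) x +
        (Fin.cons 0 (curveWeight n k) : Fin (n + 1) → ℕ) y =
      (Fin.cons 0 (curveWeight n k) : Fin (n + 1) → ℕ) x' +
        (Fin.cons 0 (curveWeight n k) : Fin (n + 1) → ℕ) y') :
    (x = x' ∧ y = y') ∨ (x = y' ∧ y = x') := by
  set o : Fin (n + 1) → ℕ := Fin.cons 0 (curveWeight n k) with ho
  let δ : Fin (n + 1) → Fin (n + 1) → Fin (n + 1) → ℕ := fun x y =>
    Pi.single x 1 + Pi.single y 1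
  have hsum : ∀ x y, ∑ i, δ x y i = 2 := fun x y => by
    simp [δ, Finset.sum_add_distrib]
  have hw : ∀ x y, ∑ i : Fin n, δ x y i.succ * curveWeight n k i = o x + o y := fun x y => by
    have h1 : ∑ i, δ x y i * o i = o x + o y := by
      simp [δ, add_mul, Finset.sum_add_distrib, Pi.single_apply]
    rw [← h1, Fin.sum_univ_succ]
    simp [ho]
  have hle : ∀ x y, ∑ i : Fin n, δ x y i.succ ≤ k := fun x y => by
    have := hsum x y
    rw [Fin.sum_univ_succ] at this
    omega
  have hs := sum_mul_curveWeight_injective (hle x y) (hle x' y') (by rw [hw, hw, h])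
  have hδ : δ x y = δ x' y' := by
    funext i
    refine Fin.cases ?_ (fun j => congrFun hs j) i
    have e1 := hsum x y
    have e2 := hsum x' y'
    rw [Fin.sum_univ_succ] at e1 e2
    have e3 : ∑ i : Fin n, δ x y i.succ = ∑ i : Fin n, δ x' y' i.succ :=
      Finset.sum_congr rfl fun i _ => congrFun hs i
    omega
  have hx := congrFun hδ x
  have hy := congrFun hδ y
  have hx' := congrFun hδ x'
  have hy' := congrFun hδ y'
  simp only [δ, Pi.add_apply, Pi.single_apply] at hx hy hx' hy'
  grind

end Weights

/-! ### Nondegenerate monomial curves -/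

section Curves

open Filter Topology Asymptotics

/-- The monomial curve `t ↦ p + (t ^ N₁, …, t ^ Nₙ)`. -/
def monomialCurve {n : ℕ} (p : AffChart n) (N : Fin n → ℕ) (t : ℂ) : AffChart n :=
  p + WithLp.toLp 2 fun i => t ^ N i

theorem differentiable_monomialCurve {n : ℕ} (p : AffChart n) (N : Fin n → ℕ) :
    Differentiable ℂ (monomialCurve p N) := by
  unfold monomialCurve
  refine (differentiable_const p).add ?_
  rw [differentiable_euclidean]
  intro i
  simp only
  fun_prop

theorem monomialCurve_zero {n : ℕ} (p : AffChart n) {N : Fin n → ℕ} (hN : ∀ i, 0 < N i) :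
    monomialCurve p N 0 = p := by
  ext i
  simp [monomialCurve, (hN i).ne']

theorem DifferentiableOn.analyticAt_comp_monomialCurve {n : ℕ} {U : Set (AffChart n)}
    (hU : IsOpen U) {f : AffChart n → ℂ} (hf : DifferentiableOn ℂ f U) {p : AffChart n} (hp : p ∈ U)
    {N : Fin n → ℕ} (hN : ∀ i, 0 < N i) : AnalyticAt ℂ (fun t => f (monomialCurve p N t)) 0 := by
  have hd := differentiable_monomialCurve p N
  have hO : IsOpen (monomialCurve p N ⁻¹' U) := hU.preimage hd.continuous
  refine DifferentiableOn.analyticAt (s := monomialCurve p N ⁻¹' U)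
    (hf.comp hd.differentiableOn fun s hs => hs) (hO.mem_nhds ?_)
  rwa [Set.mem_preimage, monomialCurve_zero p hN]

theorem monomialCurve_sub_isBigO {n k : ℕ} (p : AffChart n) :
    (fun t => ‖monomialCurve p (curveWeight n k) t - p‖) =O[𝓝 0]
      fun t : ℂ => ‖t‖ ^ ((k + 1) ^ n) := by
  refine IsBigO.of_bound n ?_
  filter_upwards [Metric.ball_mem_nhds (0 : ℂ) one_pos] with t ht
  have ht1 : ‖t‖ ≤ 1 := (mem_ball_zero_iff.1 ht).le
  rw [monomialCurve, add_sub_cancel_left, norm_norm, norm_pow, norm_norm]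
  have h1 : (WithLp.toLp 2 fun i => t ^ curveWeight n k i : AffChart n) =
      ∑ i, EuclideanSpace.single i (t ^ curveWeight n k i) := by
    ext j
    simp [Pi.single_apply]
  rw [h1]
  refine (norm_sum_le _ _).trans ?_
  refine (Finset.sum_le_card_nsmul _ _ (‖t‖ ^ ((k + 1) ^ n)) fun i _ => ?_).trans (by simp)
  rw [PiLp.norm_single, norm_pow]
  exact pow_le_pow_of_le_one (norm_nonneg t) ht1 (Nat.le_add_right _ _)

/-- A polynomial of degree at most `k` that vanishes to high order along a monomial curve with
generic weights is zero. -/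
theorem MvPolynomial.eq_zero_of_isBigO_monomial {n k : ℕ} {P : MvPolynomial (Fin n) ℂ}
    (hP : P.totalDegree ≤ k)
    (hO : (fun t : ℂ => MvPolynomial.eval (fun i => t ^ curveWeight n k i) P) =O[𝓝 0]
      fun t => ‖t‖ ^ ((k + 1) ^ n * (k + 1))) : P = 0 := by
  have hdeg : ∀ d ∈ P.support, ∑ i, d i ≤ k := fun d hd => by
    have := (MvPolynomial.le_totalDegree hd).trans hP
    rwa [Finsupp.sum_fintype _ _ fun _ => rfl] at this
  set o : (Fin n →₀ ℕ) → ℕ := fun d => ∑ i, d i * curveWeight n k i with ho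
  have heval : (fun t : ℂ => MvPolynomial.eval (fun i => t ^ curveWeight n k i) P) =
      fun t => ∑ d ∈ P.support, P.coeff d * (t ^ o d) := by
    funext t
    rw [MvPolynomial.eval_eq']
    refine Finset.sum_congr rfl fun d _ => ?_
    rw [ho, ← Finset.prod_pow_eq_pow_sum]
    congr 1
    refine Finset.prod_congr rfl fun i _ => ?_
    rw [← pow_mul, mul_comm]
  rw [heval] at hO
  have hw : ∀ d ∈ P.support, AnalyticAt ℂ (fun t : ℂ => t ^ o d) 0 := fun d _ =>
    analyticAt_id.pow _
  have han : AnalyticAt ℂ (fun t => ∑ d ∈ P.support, P.coeff d * (t ^ o d)) 0 :=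
    Finset.analyticAt_fun_sum _ fun d hd => analyticAt_const.mul (hw d hd)
  have hder := natCast_le_analyticOrderAt_iff_iteratedDeriv_eq_zero han |>.1
    (han.natCast_le_analyticOrderAt_of_isBigO hO)
  have hcoef := eq_zero_of_iteratedDeriv_sum_eq_zero P.support hw (o := o)
    (fun d hd d' hd' h => DFunLike.coe_injective
      (sum_mul_curveWeight_injective (hdeg d hd) (hdeg d' hd') h))
    (fun d _ => by
      simpa [Pi.pow_def] using analyticOrderAt_centeredMonomial (𝕜 := ℂ) (z₀ := 0) (n := o d))
    (fun d => P.coeff d) (fun d hd => hder _ (sum_mul_curveWeight_lt (hdeg d hd)))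
  ext d
  by_cases hd : d ∈ P.support
  · simpa using hcoef d hd
  · simpa using hd

/-- Linearly independent holomorphic functions stay independent along a suitable monomial curve. -/
theorem exists_nondegenerate_curve {n r : ℕ} {p : AffChart n} {R : ℝ} (hR : 0 < R)
    {g : Fin r → AffChart n → ℂ} (hg : ∀ i, DifferentiableOn ℂ (g i) (Metric.ball p R))
    (hind : ∀ c : Fin r → ℂ, (∀ z ∈ Metric.ball p R, ∑ i, c i * g i z = 0) → c = 0) :
    ∃ k : ℕ, 2 ≤ k ∧ ∀ c : Fin r → ℂ,
      (∀ᶠ t in 𝓝 (0 : ℂ), ∑ i, c i * g i (monomialCurve p (curveWeight n k) t) = 0) → c = 0 := by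
  have hG : ∀ c : Fin r → ℂ, DifferentiableOn ℂ (fun y => ∑ i, c i * g i y) (Metric.ball p R) :=
    fun c => DifferentiableOn.fun_sum fun i _ => (hg i).const_mul (c i)
  let K : ℕ → Submodule ℂ (Fin r → ℂ) := fun k =>
    { carrier := {c | (fun y => ∑ i, c i * g i y) =O[𝓝 p] fun y => ‖y - p‖ ^ k}
      add_mem' := fun {c c'} hc hc' => by
        refine (IsBigO.add hc hc').congr_left fun y => ?_
        simp [add_mul, Finset.sum_add_distrib]
      zero_mem' := by
        simpa using isBigO_zero (fun y : AffChart n => ‖y - p‖ ^ k) (𝓝 p)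
      smul_mem' := fun s c hc => by
        refine (IsBigO.const_mul_left hc s).congr_left fun y => ?_
        simp [Finset.mul_sum, mul_assoc] }
  have hanti : Antitone K := by
    intro k l hkl c hc
    refine IsBigO.trans hc (IsBigO.of_bound 1 ?_)
    filter_upwards [Metric.ball_mem_nhds p one_pos] with y hy
    rw [norm_pow, norm_pow, norm_norm, one_mul]
    exact pow_le_pow_of_le_one (norm_nonneg _) (mem_ball_iff_norm.1 hy).le hkl
  -- `K k` collects the combinations vanishing to order `k` at `p`. This descending chain
  -- stabilises, and its limit consists of flat functions, hence is zero by independence.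
  obtain ⟨k₀, hk₀⟩ := IsArtinian.monotone_stabilizes
    (⟨fun k => OrderDual.toDual (K k), fun _ _ h => hanti h⟩ : ℕ →o (Submodule ℂ (Fin r → ℂ))ᵒᵈ)
  have hbot : ∀ c ∈ K k₀, c = 0 := by
    intro c hc
    refine hind c fun z hz => (hG c).eqOn_zero_of_flat (fun k => ?_) hz
    rcases le_total k₀ k with h | h
    · have : K k₀ = K k := hk₀ k h
      exact (this ▸ hc : c ∈ K k)
    · exact hanti h hc
  -- The `2` serves the Sidon property, `k₀` the nondegeneracy.
  refine ⟨max k₀ 2, le_max_right _ _, fun c hc => ?_⟩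
  set k := max k₀ 2 with hk
  obtain ⟨P, hP, hPO⟩ := (hG c).exists_mvPolynomial_isBigO hR k
  have hγ : Tendsto (monomialCurve p (curveWeight n k)) (𝓝 0) (𝓝 p) := by
    have h0 : monomialCurve p (curveWeight n k) 0 = p :=
      monomialCurve_zero p fun i => Nat.add_pos_left (by positivity) _
    simpa [h0] using (differentiable_monomialCurve p (curveWeight n k)).continuous.tendsto 0
  have hP0 : P = 0 := by
    refine MvPolynomial.eq_zero_of_isBigO_monomial hP ?_
    have h1 := (hPO.comp_tendsto hγ).trans
      (((monomialCurve_sub_isBigO (k := k) p).pow (k + 1)).congr_right fun t => (pow_mul _ _ _).symm)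
    refine (h1.neg_left).congr' ?_ EventuallyEq.rfl
    filter_upwards [hc] with t ht
    simp only [Function.comp_apply, ht, zero_sub, neg_neg]
    simp [monomialCurve]
  -- With zero Taylor polynomial of degree `k`, the combination vanishes to order `k + 1 ≥ k₀`.
  refine hbot c (hanti (show k₀ ≤ k + 1 by omega) ?_)
  show (fun y => ∑ i, c i * g i y) =O[𝓝 p] fun y => ‖y - p‖ ^ (k + 1)
  simpa [hP0] using hPO

end Curves

/-! ### Component spans as submodules of the algebra of functions -/

section ComponentSpans

variable {n : ℕ} {ι κ : Type}

/-- The span of the components of a mapping, as functions on the whole chart. -/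
def componentSpan (ψ : AffChart n → ι → ℂ) : Submodule ℂ (AffChart n → ℂ) :=
  Submodule.span ℂ (Set.range fun (j : ι) (z : AffChart n) => ψ z j)

/-- Restriction of functions to a subset, as an algebra homomorphism. -/
def restrictHom (S : Set (AffChart n)) : (AffChart n → ℂ) →ₐ[ℂ] (S → ℂ) where
  toFun f z := f z
  map_one' := rfl
  map_mul' _ _ := rfl
  map_zero' := rfl
  map_add' _ _ := rfl
  commutes' _ := rfl

@[simp]
theorem restrictHom_apply (S : Set (AffChart n)) (f : AffChart n → ℂ) (z : S) :
    restrictHom S f z = f z := rfl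

/-- The dimension of the space of restrictions to `S` of the functions in `V`. -/
def rankOn (S : Set (AffChart n)) (V : Submodule ℂ (AffChart n → ℂ)) : ℕ :=
  Module.finrank ℂ (V.map (restrictHom S).toLinearMap)

theorem map_componentSpan (S : Set (AffChart n)) (ψ : AffChart n → ι → ℂ) :
    (componentSpan ψ).map (restrictHom S).toLinearMap =
      Submodule.span ℂ (Set.range fun (j : ι) (z : S) => ψ z j) := by
  rw [componentSpan, Submodule.map_span, ← Set.range_comp]
  rfl

theorem componentRank_eq_rankOn (S : Set (AffChart n)) (ψ : AffChart n → ι → ℂ) :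
    componentRank S ψ = rankOn S (componentSpan ψ) := by
  rw [rankOn, map_componentSpan, componentRank]

theorem mem_componentSpan (ψ : AffChart n → ι → ℂ) (j : ι) :
    (fun z => ψ z j) ∈ componentSpan ψ := Submodule.subset_span ⟨j, rfl⟩

/-- Turns tensor powers into powers of submodules, so that ranks can be studied by submodule
multiplication. -/
theorem componentSpan_tensorPower (ψ : AffChart n → ι → ℂ) (c : ℕ) :
    componentSpan (tensorPower ψ c) = componentSpan ψ ^ c := by
  rw [componentSpan, componentSpan, Submodule.span_pow]
  congr 1
  ext f
  rw [Set.mem_pow]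
  constructor
  · rintro ⟨J, rfl⟩
    refine ⟨fun i => ⟨fun z => ψ z (J i), J i, rfl⟩, ?_⟩
    rw [List.prod_ofFn]
    ext z
    simp [tensorPower]
  · rintro ⟨F, rfl⟩
    choose J hJ using fun i => (F i).2
    refine ⟨J, ?_⟩
    rw [List.prod_ofFn]
    ext z
    simp only [tensorPower, Finset.prod_apply]
    exact Finset.prod_congr rfl fun i _ => congrFun (hJ i) z

theorem finiteDimensional_map_componentSpan [Finite ι] (S : Set (AffChart n))
    (ψ : AffChart n → ι → ℂ) :
    FiniteDimensional ℂ ((componentSpan ψ).map (restrictHom S).toLinearMap) := by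
  rw [map_componentSpan]
  exact FiniteDimensional.span_of_finite ℂ (Set.finite_range _)

theorem rankOn_mono {S : Set (AffChart n)} {V W : Submodule ℂ (AffChart n → ℂ)} (h : V ≤ W)
    [FiniteDimensional ℂ (W.map (restrictHom S).toLinearMap)] : rankOn S V ≤ rankOn S W :=
  Submodule.finrank_mono (Submodule.map_mono h)

theorem rankOn_componentSpan_le [Fintype ι] (S : Set (AffChart n)) (ψ : AffChart n → ι → ℂ) :
    rankOn S (componentSpan ψ) ≤ Fintype.card ι := by
  rw [rankOn, map_componentSpan]
  exact finrank_range_le_card _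

theorem finiteDimensional_map_mul {S : Set (AffChart n)} {V W : Submodule ℂ (AffChart n → ℂ)}
    [FiniteDimensional ℂ (V.map (restrictHom S).toLinearMap)]
    [FiniteDimensional ℂ (W.map (restrictHom S).toLinearMap)] :
    FiniteDimensional ℂ ((V * W).map (restrictHom S).toLinearMap) := by
  rw [Submodule.map_mul]
  rw [← Submodule.mulMap_range]
  infer_instance

/-- The product of the restricted spaces is the image of their tensor product under multiplication.
-/
theorem rankOn_mul_le (S : Set (AffChart n)) (V W : Submodule ℂ (AffChart n → ℂ))
    [FiniteDimensional ℂ (V.map (restrictHom S).toLinearMap)]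
    [FiniteDimensional ℂ (W.map (restrictHom S).toLinearMap)] :
    rankOn S (V * W) ≤ rankOn S V * rankOn S W := by
  rw [rankOn, Submodule.map_mul, ← Submodule.mulMap_range]
  refine (LinearMap.finrank_range_le _).trans ?_
  rw [Module.finrank_tensorProduct]
  rfl

/-- The number of monomials of degree `c` in `m + 1` variables bounds the rank of a tensor power. -/
theorem componentRank_tensorPower_le {m : ℕ} (S : Set (AffChart n))
    (ψ : AffChart n → Fin (m + 1) → ℂ) (c : ℕ) :
    componentRank S (tensorPower ψ c) ≤ (m + c).choose c := by
  -- Multiplication commutes, so a component depends only on the multiset of its indices.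
  let T : Sym (Fin (m + 1)) c → S → ℂ := fun s z => (s.1.map fun j => ψ z j).prod
  have hsub : Set.range (fun (J : Fin c → Fin (m + 1)) (z : S) => tensorPower ψ c z J) ⊆
      Set.range T := by
    rintro _ ⟨J, rfl⟩
    refine ⟨⟨Finset.univ.val.map J, by simp⟩, ?_⟩
    funext z
    simp [T, tensorPower, Finset.prod, Function.comp_def]
  have hfin : FiniteDimensional ℂ (Submodule.span ℂ (Set.range T)) :=
    FiniteDimensional.span_of_finite ℂ (Set.finite_range _)
  refine (Submodule.finrank_mono (Submodule.span_mono hsub)).trans ?_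
  refine (finrank_range_le_card T).trans (le_of_eq ?_)
  rw [Sym.card_sym_eq_choose, Fintype.card_fin]
  congr 1
  omega

/-- Monomials of degree at most `c` in `m` variables, sorted by degree; the `+ 1` is the constant
monomial. -/
theorem sum_choose_add_one (m c : ℕ) :
    (∑ k ∈ Finset.Icc 1 c, (m + k - 1).choose k) + 1 = (m + c).choose c := by
  induction c with
  | zero => simp
  | succ c ih =>
    rw [Finset.sum_Icc_succ_top (by omega), add_right_comm, ih, ← add_assoc, Nat.add_sub_cancel,
      Nat.choose_succ_succ]

end ComponentSpans

/-! ### From vanishing orders to sumset bounds on ranks -/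

section VanishingOrders

open Filter Topology
open scoped Pointwise

variable {n : ℕ}

/-- The finite vanishing orders at `0` of the functions in `V` along the curve `γ`. -/
def vanishingOrders (γ : ℂ → AffChart n) (V : Submodule ℂ (AffChart n → ℂ)) : Set ℕ :=
  {a | ∃ f ∈ V, AnalyticAt ℂ (fun t => f (γ t)) 0 ∧ analyticOrderAt (fun t => f (γ t)) 0 = a}

theorem add_mem_vanishingOrders {γ : ℂ → AffChart n} {V W : Submodule ℂ (AffChart n → ℂ)} {a b : ℕ}
    (ha : a ∈ vanishingOrders γ V) (hb : b ∈ vanishingOrders γ W) :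
    a + b ∈ vanishingOrders γ (V * W) := by
  obtain ⟨f, hf, hfa, hfo⟩ := ha
  obtain ⟨g, hg, hga, hgo⟩ := hb
  refine ⟨f * g, Submodule.mul_mem_mul hf hg, hfa.mul hga, ?_⟩
  rw [Nat.cast_add, ← hfo, ← hgo]
  exact analyticOrderAt_mul hfa hga

theorem zero_mem_vanishingOrders_one (γ : ℂ → AffChart n) :
    0 ∈ vanishingOrders γ (1 : Submodule ℂ (AffChart n → ℂ)) := by
  refine ⟨1, Submodule.one_le.1 le_rfl, analyticAt_const, ?_⟩
  simp [analyticOrderAt_eq_zero]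

/-- Functions with distinct orders along a curve that stays in `S` near `0` are independent on `S`.
-/
theorem card_le_rankOn {γ : ℂ → AffChart n} {S : Set (AffChart n)} (hγ : ∀ᶠ t in 𝓝 0, γ t ∈ S)
    {V : Submodule ℂ (AffChart n → ℂ)} [FiniteDimensional ℂ (V.map (restrictHom S).toLinearMap)]
    {A : Finset ℕ} (hA : (A : Set ℕ) ⊆ vanishingOrders γ V) : A.card ≤ rankOn S V := by
  have hA' : ∀ a : ℕ, ∃ f : AffChart n → ℂ, a ∈ A → f ∈ V ∧
      AnalyticAt ℂ (fun t => f (γ t)) 0 ∧ analyticOrderAt (fun t => f (γ t)) 0 = a := fun a => by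
    by_cases ha : a ∈ A
    · obtain ⟨f, hf⟩ := hA ha
      exact ⟨f, fun _ => hf⟩
    · exact ⟨0, fun h => absurd h ha⟩
  choose f hf using hA'
  let v : A → V.map (restrictHom S).toLinearMap := fun a =>
    ⟨restrictHom S (f a), f a, (hf a a.2).1, rfl⟩
  have hv : LinearIndependent ℂ v := by
    rw [Fintype.linearIndependent_iff]
    intro c hc a
    have hc' : ∀ z : S, ∑ a, c a * f a z = 0 := fun z => by
      have := congrFun (congrArg (V.map (restrictHom S).toLinearMap).subtype hc) z
      rw [map_sum, Finset.sum_apply] at this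
      simpa [v] using this
    have hev : (fun t => ∑ a ∈ (Finset.univ : Finset A), c a * f a (γ t)) =ᶠ[𝓝 0]
        fun _ => (0 : ℂ) := hγ.mono fun t ht => hc' ⟨γ t, ht⟩
    refine eq_zero_of_iteratedDeriv_sum_eq_zero (Finset.univ : Finset A)
      (w := fun a t => f a (γ t)) (o := fun a => (a : ℕ)) (fun a _ => (hf a a.2).2.1)
      Subtype.val_injective.injOn (fun a _ => (hf a a.2).2.2) c (fun a _ => ?_) a (Finset.mem_univ a)
    rw [hev.iteratedDeriv_eq]
    simp
  simpa [rankOn] using hv.fintype_card_le_finrank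

/-- Along a suitable monomial curve through the centre of a ball, a space of holomorphic functions
realises as many vanishing orders as its rank. -/
theorem exists_curve_vanishingOrders {p : AffChart n} {R : ℝ} (hR : 0 < R)
    {V : Submodule ℂ (AffChart n → ℂ)} (hV : ∀ f ∈ V, DifferentiableOn ℂ f (Metric.ball p R))
    [FiniteDimensional ℂ (V.map (restrictHom (Metric.ball p R)).toLinearMap)] :
    ∃ k, 2 ≤ k ∧ ∃ A : Finset ℕ, A.card = rankOn (Metric.ball p R) V ∧
      (A : Set ℕ) ⊆ vanishingOrders (monomialCurve p (curveWeight n k)) V := by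
  set B := Metric.ball p R
  let b := Module.finBasis ℂ (V.map (restrictHom B).toLinearMap)
  choose g hgV hgb using fun i => (b i).2
  have hind : ∀ c : Fin _ → ℂ, (∀ z ∈ B, ∑ i, c i * g i z = 0) → c = 0 := by
    intro c hc
    have := Fintype.linearIndependent_iff.1 b.linearIndependent c (by
      ext z
      have h1 : ∀ i, (b i : B → ℂ) z = g i z := fun i => (congrFun (hgb i) z).symm
      simpa [h1] using hc z z.2)
    exact funext this
  have hg : ∀ i, DifferentiableOn ℂ (g i) B := fun i => hV _ (hgV i)
  obtain ⟨k, hk, hkc⟩ := exists_nondegenerate_curve hR hg hind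
  have hN : ∀ i, 0 < curveWeight n k i := fun i => Nat.add_pos_left (by positivity) _
  have han : ∀ i, AnalyticAt ℂ (fun t => g i (monomialCurve p (curveWeight n k) t)) 0 := fun i =>
    (hg i).analyticAt_comp_monomialCurve Metric.isOpen_ball (Metric.mem_ball_self hR) hN
  obtain ⟨A, hAc, hA⟩ := exists_finset_analyticOrderAt han hkc
  refine ⟨k, hk, A, by simpa [rankOn] using hAc, fun a ha => ?_⟩
  obtain ⟨c, hc⟩ := hA a ha
  refine ⟨∑ i, c i • g i, Submodule.sum_mem _ fun i _ => Submodule.smul_mem _ _ (hgV i), ?_, ?_⟩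
  · simpa using Finset.analyticAt_fun_sum Finset.univ fun i _ =>
      (analyticAt_const (v := c i)).mul (han i)
  · simpa using hc

theorem eventually_monomialCurve_mem_ball (p : AffChart n) {R : ℝ} (hR : 0 < R) (k : ℕ) :
    ∀ᶠ t in 𝓝 0, monomialCurve p (curveWeight n k) t ∈ Metric.ball p R := by
  have h0 : monomialCurve p (curveWeight n k) 0 = p :=
    monomialCurve_zero p fun i => Nat.add_pos_left (by positivity) _
  have := (differentiable_monomialCurve p (curveWeight n k)).continuous.tendsto 0
  rw [h0] at this
  exact this.eventually (Metric.ball_mem_nhds p hR)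

/-- Hopf's inequality for powers of a space of holomorphic functions. -/
theorem mul_add_one_le_rankOn_pow {p : AffChart n} {R : ℝ} (hR : 0 < R)
    {V : Submodule ℂ (AffChart n → ℂ)} (hV : ∀ f ∈ V, DifferentiableOn ℂ f (Metric.ball p R))
    [FiniteDimensional ℂ (V.map (restrictHom (Metric.ball p R)).toLinearMap)] {d c : ℕ}
    [FiniteDimensional ℂ ((V ^ c).map (restrictHom (Metric.ball p R)).toLinearMap)]
    (hd : rankOn (Metric.ball p R) V = d + 1) : c * d + 1 ≤ rankOn (Metric.ball p R) (V ^ c) := by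
  obtain ⟨k, -, A, hAc, hA⟩ := exists_curve_vanishingOrders hR hV
  have hAne : A.Nonempty := Finset.card_pos.1 (by omega)
  suffices H : ∀ c : ℕ, ∃ A' : Finset ℕ, c * d + 1 ≤ A'.card ∧
      (A' : Set ℕ) ⊆ vanishingOrders (monomialCurve p (curveWeight n k)) (V ^ c) by
    obtain ⟨A', h1, h2⟩ := H c
    exact h1.trans (card_le_rankOn (eventually_monomialCurve_mem_ball p hR k) h2)
  intro c
  induction c with
  | zero => exact ⟨{0}, by simp, by simpa using zero_mem_vanishingOrders_one _⟩
  | succ c ih =>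
    obtain ⟨A', h1, h2⟩ := ih
    refine ⟨A' + A, ?_, ?_⟩
    · have := cauchy_davenport_add_of_linearOrder_isCancelAdd
        (Finset.card_pos.1 (by omega) : A'.Nonempty) hAne
      rw [add_mul]
      omega
    · intro x hx
      obtain ⟨a, ha, b, hb, rfl⟩ := Finset.mem_add.1 (Finset.mem_coe.1 hx)
      rw [pow_succ]
      exact add_mem_vanishingOrders (h2 ha) (hA hb)

/-- Translates of a Sidon set overlap in at most one point, so sumsets with it are large. -/
theorem Finset.sum_le_card_add_of_sidon {O : Finset ℕ}
    (hO : ∀ x ∈ O, ∀ y ∈ O, ∀ x' ∈ O, ∀ y' ∈ O, x + y = x' + y' →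
      (x = x' ∧ y = y') ∨ (x = y' ∧ y = x')) (A : Finset ℕ) :
    ∑ k ∈ Finset.range A.card, (O.card - k) ≤ (A + O).card := by
  induction A using Finset.induction_on with
  | empty => simp
  | insert a A ha ih =>
    rw [Finset.card_insert_of_notMem ha, Finset.sum_range_succ, Finset.insert_eq,
      Finset.union_add, Finset.union_comm]
    -- Each point of `a + O` already in `A + O` lies in some `a' + O`, `a' ∈ A`. The Sidon property
    -- allows at most one such point per `a'`.
    have hinter : ((A + O) ∩ ({a} + O)).card ≤ A.card := by
      refine Finset.card_le_card_of_forall_subsingleton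
        (fun x a' => x ∈ ({a'} + O : Finset ℕ)) (fun x hx => ?_) (fun a' ha' => ?_)
      · obtain ⟨a', ha', y, hy, rfl⟩ := Finset.mem_add.1 (Finset.mem_inter.1 hx).1
        exact ⟨a', ha', Finset.add_mem_add (Finset.mem_singleton_self _) hy⟩
      · rintro u ⟨hu, hu'⟩ v ⟨hv, hv'⟩
        rw [Finset.mem_inter] at hu hv
        simp only [Finset.mem_add, Finset.mem_singleton] at hu hu' hv hv'
        obtain ⟨b1, hb1, x, hx, hxu⟩ := hu.2
        obtain ⟨b2, hb2, y, hy, hyu⟩ := hu'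
        obtain ⟨b3, hb3, x', hx', hxv⟩ := hv.2
        obtain ⟨b4, hb4, y', hy', hyv⟩ := hv'
        have hne : a ≠ a' := fun h => ha (h ▸ ha')
        rcases hO x hx y' hy' x' hx' y hy (by omega) with h | h <;> omega
    have hcard : ({a} + O : Finset ℕ).card = O.card := Finset.card_singleton_add _ _
    have := Finset.card_union_add_card_inter (A + O) ({a} + O)
    -- Covers the case where the truncated `O.card - A.card` is zero.
    have := Finset.card_le_card (Finset.subset_union_left (s₁ := A + O) (s₂ := {a} + O))
    omega

/-- The product of a space of holomorphic functions with the space of affine functions is large. -/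
theorem sum_le_rankOn_affine_mul {p : AffChart n} {R : ℝ} (hR : 0 < R)
    {V : Submodule ℂ (AffChart n → ℂ)} (hV : ∀ f ∈ V, DifferentiableOn ℂ f (Metric.ball p R))
    [FiniteDimensional ℂ (V.map (restrictHom (Metric.ball p R)).toLinearMap)] {s : ℕ}
    (hs : s ≤ rankOn (Metric.ball p R) V) :
    ∑ k ∈ Finset.range s, (n + 1 - k) ≤
      rankOn (Metric.ball p R) (componentSpan (consOne fun z : AffChart n => z) * V) := by
  obtain ⟨k, hk, A₀, hAc, hA₀⟩ := exists_curve_vanishingOrders hR hV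
  obtain ⟨A, hAA₀, hAs⟩ := Finset.exists_subset_card_eq (hs.trans hAc.ge)
  set o : Fin (n + 1) → ℕ := Fin.cons 0 (curveWeight n k) with ho
  have hinj : Function.Injective o := fun x y hxy => by
    rcases curveWeight_sidon hk (x := x) (y := x) (x' := y) (y' := y)
      (show o x + o x = o y + o y by rw [hxy]) with h | h <;> exact h.1
  have hsid : ∀ x ∈ Finset.univ.image o, ∀ y ∈ Finset.univ.image o, ∀ x' ∈ Finset.univ.image o,
      ∀ y' ∈ Finset.univ.image o, x + y = x' + y' → (x = x' ∧ y = y') ∨ (x = y' ∧ y = x') := by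
    simp only [Finset.mem_image, Finset.mem_univ, true_and]
    rintro _ ⟨x, rfl⟩ _ ⟨y, rfl⟩ _ ⟨x', rfl⟩ _ ⟨y', rfl⟩ h
    rcases curveWeight_sidon hk h with h | h
    · exact Or.inl ⟨by rw [h.1], by rw [h.2]⟩
    · exact Or.inr ⟨by rw [h.1], by rw [h.2]⟩
  have hcard := Finset.sum_le_card_add_of_sidon hsid A
  rw [Finset.card_image_of_injective _ hinj, Finset.card_univ, Fintype.card_fin, hAs] at hcard
  have _ := finiteDimensional_map_componentSpan (Metric.ball p R)
    (consOne fun z : AffChart n => z)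
  have _ := finiteDimensional_map_mul (S := Metric.ball p R)
    (V := componentSpan (consOne fun z : AffChart n => z)) (W := V)
  refine hcard.trans (card_le_rankOn (eventually_monomialCurve_mem_ball p hR k) fun x hx => ?_)
  obtain ⟨a, ha, b, hb, rfl⟩ := Finset.mem_add.1 (Finset.mem_coe.1 hx)
  rw [add_comm a b]
  refine add_mem_vanishingOrders ?_ (hA₀ (hAA₀ ha))
  obtain ⟨i, -, rfl⟩ := Finset.mem_image.1 hb
  have h1 := mem_componentSpan (consOne fun z : AffChart n => z)
  have hone : (1 : AffChart n → ℂ) ∈ componentSpan (consOne fun z : AffChart n => z) := h1 0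
  refine Fin.cases ?_ (fun i => ?_) i
  · exact ⟨1, hone, analyticAt_const, by simp [ho, analyticOrderAt_eq_zero]⟩
  -- The centred coordinate `zᵢ - pᵢ`, which lies in the affine span, is exactly the `i`-th power of
  -- `t` on the curve.
  · have hfun : (fun t : ℂ => ((fun z : AffChart n => z i) - p i • (1 : AffChart n → ℂ))
        (monomialCurve p (curveWeight n k) t)) = fun t => t ^ curveWeight n k i := by
      funext t
      simp [monomialCurve]
    refine ⟨(fun z => z i) - p i • 1, Submodule.sub_mem _ ?_ (Submodule.smul_mem _ _ hone), ?_, ?_⟩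
    · simpa [consOne] using h1 i.succ
    · rw [hfun]
      exact analyticAt_id.pow _
    · rw [hfun]
      simpa [Pi.pow_def, ho] using
        analyticOrderAt_centeredMonomial (𝕜 := ℂ) (z₀ := 0) (n := curveWeight n k i)

end VanishingOrders

/-! ### Polarization and equality of spans -/

section Polarization

open Filter Topology
open scoped ComplexConjugate

/-- A holomorphic function on a convex domain containing `0` that vanishes at the real points of the
domain is zero. -/
theorem DifferentiableOn.eq_zero_of_forall_real {D : Set ℂ} (hD : IsOpen D) (hc : Convex ℝ D)
    (h0 : (0 : ℂ) ∈ D) {g : ℂ → ℂ} (hg : DifferentiableOn ℂ g D)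
    (hr : ∀ t : ℝ, (t : ℂ) ∈ D → g t = 0) : ∀ z ∈ D, g z = 0 := by
  refine (hg.analyticOnNhd hD).eqOn_zero_of_preconnected_of_frequently_eq_zero hc.isPreconnected
    h0 ?_
  have ht : Tendsto (fun t : ℝ => (t : ℂ)) (𝓝[≠] 0) (𝓝[≠] 0) := by
    refine tendsto_nhdsWithin_of_tendsto_nhds_of_eventually_within _ ?_ ?_
    · exact (Complex.continuous_ofReal.tendsto' 0 0 (by simp)).mono_left nhdsWithin_le_nhds
    · filter_upwards [self_mem_nhdsWithin] with t ht
      simpa using ht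
  refine ht.frequently (Eventually.frequently ?_)
  have hmem : ∀ᶠ t : ℝ in 𝓝[≠] 0, (t : ℂ) ∈ D :=
    ht.eventually (nhdsWithin_le_nhds (hD.mem_nhds h0))
  exact hmem.mono hr

/-- Polarization on a disc: a holomorphic function of `(s, σ)` vanishing for `σ = conj s` is
zero. -/
theorem eq_zero_of_forall_conj {r : ℝ} {G : ℂ × ℂ → ℂ}
    (hG : DifferentiableOn ℂ G (Metric.ball 0 r ×ˢ Metric.ball 0 r))
    (hdiag : ∀ s ∈ Metric.ball (0 : ℂ) r, G (s, conj s) = 0) {s σ : ℂ}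
    (hs : s ∈ Metric.ball (0 : ℂ) r) (hσ : σ ∈ Metric.ball (0 : ℂ) r) : G (s, σ) = 0 := by
  have hr : 0 < r := Metric.pos_of_mem_ball hs
  have hconv : Convex ℝ (Metric.ball (0 : ℂ) r) := convex_ball 0 r
  have hopen : ∀ a b : ℂ → ℂ, Continuous a → Continuous b →
      IsOpen {x | a x ∈ Metric.ball (0 : ℂ) r ∧ b x ∈ Metric.ball (0 : ℂ) r} := fun a b ha hb =>
    (Metric.isOpen_ball.preimage ha).inter (Metric.isOpen_ball.preimage hb)
  have hcv : ∀ p q u v : ℂ, Convex ℝ {x : ℂ | p + x * u ∈ Metric.ball (0 : ℂ) r ∧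
      q + x * v ∈ Metric.ball (0 : ℂ) r} := by
    intro p q u v x hx y hy a b ha hb hab
    have key : ∀ p u : ℂ, p + (a • x + b • y) * u = a • (p + x * u) + b • (p + y * u) := by
      intro p u
      have hab' : (a : ℂ) + b = 1 := by exact_mod_cast hab
      simp only [Complex.real_smul]
      linear_combination (-p) * hab'
    exact ⟨key p u ▸ hconv hx.1 hy.1 ha hb hab, key q v ▸ hconv hx.2 hy.2 ha hb hab⟩
  -- In coordinates `s = x + iy`, `σ = x - iy`, the locus `σ = conj s` is `x, y` real. Vanishing is
  -- continued first to complex `x`, then to complex `y`.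
  have step1 : ∀ (y : ℝ) (x : ℂ), x + Complex.I * y ∈ Metric.ball (0 : ℂ) r →
      x - Complex.I * y ∈ Metric.ball (0 : ℂ) r → |y| < r →
      G (x + Complex.I * y, x - Complex.I * y) = 0 := by
    intro y x hx1 hx2 hy
    have hset : {x : ℂ | Complex.I * y + x * 1 ∈ Metric.ball (0 : ℂ) r ∧
        -(Complex.I * y) + x * 1 ∈ Metric.ball (0 : ℂ) r} =
        {x : ℂ | x + Complex.I * y ∈ Metric.ball (0 : ℂ) r ∧
        x - Complex.I * y ∈ Metric.ball (0 : ℂ) r} := by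
      ext x
      simp [add_comm, sub_eq_add_neg]
    refine DifferentiableOn.eq_zero_of_forall_real
      (D := {x : ℂ | x + Complex.I * y ∈ Metric.ball (0 : ℂ) r ∧
        x - Complex.I * y ∈ Metric.ball (0 : ℂ) r})
      (g := fun x => G (x + Complex.I * y, x - Complex.I * y))
      (hopen _ _ (by fun_prop) (by fun_prop)) (hset ▸ hcv _ _ _ _) (by simpa using hy)
      (hG.comp (by fun_prop) fun x hx => ⟨hx.1, hx.2⟩) (fun t ht => ?_) x ⟨hx1, hx2⟩
    have := hdiag _ ht.1
    simpa [sub_eq_add_neg] using this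
  obtain ⟨x, y, hxs, hxσ⟩ : ∃ x y : ℂ, s = x + Complex.I * y ∧ σ = x - Complex.I * y :=
    ⟨(s + σ) / 2, -Complex.I * ((s - σ) / 2), by linear_combination ((s - σ) / 2) * Complex.I_sq,
      by linear_combination (-(s - σ) / 2) * Complex.I_sq⟩
  have hx : x ∈ Metric.ball (0 : ℂ) r := by
    have := hconv hs hσ (by norm_num : (0 : ℝ) ≤ 1 / 2) (by norm_num : (0 : ℝ) ≤ 1 / 2) (by norm_num)
    convert this using 1
    rw [hxs, hxσ, Complex.real_smul, Complex.real_smul]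
    push_cast
    ring
  rw [hxs] at hs ⊢
  rw [hxσ] at hσ ⊢
  have hset : {y : ℂ | x + y * Complex.I ∈ Metric.ball (0 : ℂ) r ∧
      x + y * (-Complex.I) ∈ Metric.ball (0 : ℂ) r} =
      {y : ℂ | x + Complex.I * y ∈ Metric.ball (0 : ℂ) r ∧
      x - Complex.I * y ∈ Metric.ball (0 : ℂ) r} := by
    ext y
    simp [mul_comm, sub_eq_add_neg]
  refine DifferentiableOn.eq_zero_of_forall_real
    (D := {y : ℂ | x + Complex.I * y ∈ Metric.ball (0 : ℂ) r ∧
      x - Complex.I * y ∈ Metric.ball (0 : ℂ) r})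
    (g := fun y => G (x + Complex.I * y, x - Complex.I * y))
    (hopen _ _ (by fun_prop) (by fun_prop)) (hset ▸ hcv _ _ _ _) (by simpa using hx)
    (hG.comp (by fun_prop) fun x hx => ⟨hx.1, hx.2⟩) (fun t ht => ?_) y ⟨hs, hσ⟩
  refine step1 t x ht.1 ht.2 ?_
  have h1 := mem_ball_zero_iff.1 ht.1
  have h2 := mem_ball_zero_iff.1 ht.2
  have h3 : (2 : ℂ) * (Complex.I * t) = (x + Complex.I * t) - (x - Complex.I * t) := by ring
  have h5 := norm_sub_le (x + Complex.I * t) (x - Complex.I * t)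
  rw [← h3, norm_mul, norm_mul, Complex.norm_I, one_mul, Complex.norm_real, Real.norm_eq_abs,
    Complex.norm_ofNat] at h5
  linarith

/-- Polarization along a complex line. -/
theorem sum_mul_conj_eq_zero_of_line {J : Type*} [Fintype J] {r : ℝ} {A B : J → ℂ → ℂ}
    (hA : ∀ j, DifferentiableOn ℂ (A j) (Metric.ball 0 r))
    (hB : ∀ j, DifferentiableOn ℂ (B j) (Metric.ball 0 r))
    (hdiag : ∀ s ∈ Metric.ball (0 : ℂ) r, ∑ j, A j s * conj (B j s) = 0) {s s' : ℂ}
    (hs : s ∈ Metric.ball (0 : ℂ) r) (hs' : s' ∈ Metric.ball (0 : ℂ) r) :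
    ∑ j, A j s * conj (B j s') = 0 := by
  have hconj : ∀ σ : ℂ, σ ∈ Metric.ball (0 : ℂ) r → conj σ ∈ Metric.ball (0 : ℂ) r := by simp
  have hB' : ∀ j, DifferentiableOn ℂ (fun σ => conj (B j (conj σ))) (Metric.ball 0 r) := by
    intro j σ hσ
    have h1 := ((hB j).differentiableAt (Metric.isOpen_ball.mem_nhds (hconj σ hσ))).conj_conj
    rw [Complex.conj_conj] at h1
    exact h1.differentiableWithinAt
  have := eq_zero_of_forall_conj (r := r)
    (G := fun q => ∑ j, A j q.1 * conj (B j (conj q.2))) ?_ ?_ hs (hconj s' hs')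
  · simpa using this
  · refine DifferentiableOn.fun_sum fun j _ => DifferentiableOn.mul ?_ ?_
    · exact (hA j).comp differentiableOn_fst fun q hq => hq.1
    · exact (hB' j).comp differentiableOn_snd fun q hq => hq.2
  · simpa using hdiag

/-- Polarization of sesquilinear expressions in holomorphic functions on a ball. -/
theorem sum_mul_conj_eq_zero {E : Type*} [NormedAddCommGroup E] [NormedSpace ℂ E] {J : Type*}
    [Fintype J] {p : E} {R : ℝ} {A B : J → E → ℂ}
    (hA : ∀ j, DifferentiableOn ℂ (A j) (Metric.ball p R))
    (hB : ∀ j, DifferentiableOn ℂ (B j) (Metric.ball p R))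
    (hdiag : ∀ z ∈ Metric.ball p R, ∑ j, A j z * conj (B j z) = 0) {z w : E}
    (hz : z ∈ Metric.ball p (R / 4)) (hw : w ∈ Metric.ball p (R / 4)) :
    ∑ j, A j z * conj (B j w) = 0 := by
  set u := z - p with hu
  set v := w - p with hv
  have hu4 : ‖u‖ < R / 4 := mem_ball_iff_norm.1 hz
  have hv4 : ‖v‖ < R / 4 := mem_ball_iff_norm.1 hw
  -- Discs of radius 2 contain `0` and `1`; this is why `z` and `w` are taken within `R / 4` of `p`.
  have hmem : ∀ s ∈ Metric.ball (0 : ℂ) 2, ∀ t ∈ Metric.ball (0 : ℂ) 2,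
      p + s • u + t • v ∈ Metric.ball p R := by
    intro s hs t ht
    rw [mem_ball_zero_iff] at hs ht
    rw [mem_ball_iff_norm, show p + s • u + t • v - p = s • u + t • v by abel]
    refine (norm_add_le _ _).trans_lt ?_
    rw [norm_smul, norm_smul]
    nlinarith [norm_nonneg u, norm_nonneg v, norm_nonneg s, norm_nonneg t]
  have h0 : (0 : ℂ) ∈ Metric.ball (0 : ℂ) 2 := by simp
  have h1 : (1 : ℂ) ∈ Metric.ball (0 : ℂ) 2 := by simp
  -- The arguments of `A` and `B` are separated one direction at a time: in `u` with common `t`,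
  -- then in `v`, ending at `p + u = z` and `p + v = w`.
  have key1 : ∀ t ∈ Metric.ball (0 : ℂ) 2,
      ∑ j, A j (p + (1 : ℂ) • u + t • v) * conj (B j (p + (0 : ℂ) • u + t • v)) = 0 := fun t ht =>
    sum_mul_conj_eq_zero_of_line (A := fun j s => A j (p + s • u + t • v))
      (B := fun j s => B j (p + s • u + t • v))
      (fun j => (hA j).comp (by fun_prop) fun s hs => hmem s hs t ht)
      (fun j => (hB j).comp (by fun_prop) fun s hs => hmem s hs t ht)
      (fun s hs => hdiag _ (hmem s hs t ht)) h1 h0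
  have key2 := sum_mul_conj_eq_zero_of_line (A := fun j t => A j (p + (1 : ℂ) • u + t • v))
      (B := fun j t => B j (p + (0 : ℂ) • u + t • v))
      (fun j => (hA j).comp (by fun_prop) fun t ht => hmem 1 h1 t ht)
      (fun j => (hB j).comp (by fun_prop) fun t ht => hmem 0 h0 t ht) key1 h0 h1
  simpa [hu, hv] using key2

/-- The span of the components of a mapping is spanned by its polarized square norm. -/
theorem span_range_eq_span_kernel {S ι : Type*} [Fintype ι] (φ : ι → S → ℂ) :
    Submodule.span ℂ (Set.range φ) =
      Submodule.span ℂ (Set.range fun (w : S) (z : S) => ∑ i, φ i z * conj (φ i w)) := by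
  classical
  apply le_antisymm
  · let T : EuclideanSpace ℂ ι →ₗ[ℂ] (S → ℂ) :=
      { toFun := fun x z => ∑ i, φ i z * x i
        map_add' := fun x y => by ext z; simp [mul_add, Finset.sum_add_distrib]
        map_smul' := fun c x => by ext z; simp [Finset.mul_sum, mul_left_comm] }
    let e : S → EuclideanSpace ℂ ι := fun w => WithLp.toLp 2 fun i => conj (φ i w)
    set M : Submodule ℂ (EuclideanSpace ℂ ι) := Submodule.span ℂ (Set.range e) with hM
    have hT : M.map T =
        Submodule.span ℂ (Set.range fun (w : S) (z : S) => ∑ i, φ i z * conj (φ i w)) := by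
      rw [hM, Submodule.map_span, ← Set.range_comp]
      rfl
    -- `T x` at `z` is the inner product of `e z` with `x`, so `T` kills `Mᗮ` and its whole range
    -- comes from `M`.
    have hperp : ∀ x ∈ Mᗮ, T x = 0 := by
      intro x hx
      ext z
      have := Submodule.inner_right_of_mem_orthogonal
        (Submodule.subset_span (Set.mem_range_self z) : e z ∈ M) hx
      rw [PiLp.inner_apply] at this
      simpa [T, e, mul_comm] using this
    rw [← hT, Submodule.span_le]
    rintro _ ⟨i, rfl⟩
    obtain ⟨y, hy, x, hx, hxy⟩ := M.exists_add_mem_mem_orthogonal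
      (EuclideanSpace.single i (1 : ℂ))
    have hi : T (EuclideanSpace.single i (1 : ℂ)) = φ i := by
      ext z
      simp [T]
    refine ⟨y, hy, ?_⟩
    rw [← hi, hxy, map_add, hperp x hx, add_zero]
  · rw [Submodule.span_le]
    rintro _ ⟨w, rfl⟩
    have : (fun z => ∑ i, φ i z * conj (φ i w)) = ∑ i, conj (φ i w) • φ i := by
      ext z
      simp [mul_comm]
    show (fun z => ∑ i, φ i z * conj (φ i w)) ∈ Submodule.span ℂ (Set.range φ)
    rw [this]
    exact Submodule.sum_mem _ fun i _ => Submodule.smul_mem _ _ (Submodule.subset_span ⟨i, rfl⟩)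

/-- Holomorphic mappings with equal square norms have equal component spans. -/
theorem span_range_eq_of_sum_normSq_eq {n : ℕ} {ι κ : Type} [Fintype ι] [Fintype κ]
    {p : AffChart n} {R : ℝ} {φ : AffChart n → ι → ℂ} {ψ : AffChart n → κ → ℂ}
    (hφ : ∀ i, DifferentiableOn ℂ (fun z => φ z i) (Metric.ball p R))
    (hψ : ∀ j, DifferentiableOn ℂ (fun z => ψ z j) (Metric.ball p R))
    (h : ∀ z ∈ Metric.ball p R, ∑ i, ‖φ z i‖ ^ 2 = ∑ j, ‖ψ z j‖ ^ 2) :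
    Submodule.span ℂ (Set.range fun (i : ι) (z : Metric.ball p (R / 4)) => φ z i) =
      Submodule.span ℂ (Set.range fun (j : κ) (z : Metric.ball p (R / 4)) => ψ z j) := by
  rw [span_range_eq_span_kernel fun (i : ι) (z : Metric.ball p (R / 4)) => φ z i,
    span_range_eq_span_kernel fun (j : κ) (z : Metric.ball p (R / 4)) => ψ z j]
  congr 2
  funext w z
  have := sum_mul_conj_eq_zero (J := ι ⊕ κ) (p := p) (R := R)
    (A := Sum.elim (fun i z => φ z i) fun j z => ψ z j)
    (B := Sum.elim (fun i z => φ z i) fun j z => -ψ z j)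
    (by rintro (i | j); exacts [hφ i, hψ j]) (by rintro (i | j); exacts [hφ i, (hψ j).neg])
    (fun z hz => ?_) z.2 w.2
  · simp only [Fintype.sum_sum_type, Sum.elim_inl, Sum.elim_inr, map_neg, mul_neg,
      Finset.sum_neg_distrib] at this
    exact add_neg_eq_zero.1 this
  · simp only [Fintype.sum_sum_type, Sum.elim_inl, Sum.elim_inr, map_neg, mul_neg,
      Finset.sum_neg_distrib, Complex.mul_conj, Complex.normSq_eq_norm_sq]
    rw [add_neg_eq_zero]
    exact_mod_cast h z hz

end Polarization

/-! ### The operator `∂∂̄` and pluriharmonic functions -/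

section Ddbar

open Filter Topology

variable {n N : ℕ}

theorem dbar_apply (u : AffChart N → ℂ) (z v : AffChart N) : dbar u z v =
    (1 / 2 : ℂ) * (fderiv ℝ u z v + Complex.I * fderiv ℝ u z (Complex.I • v)) := rfl

theorem dbar_I_smul (u : AffChart N → ℂ) (z v : AffChart N) :
    dbar u z (Complex.I • v) = -Complex.I * dbar u z v := by
  rw [dbar_apply, dbar_apply, smul_smul, Complex.I_mul_I, neg_one_smul, map_neg]
  linear_combination (1 / 2 : ℂ) * fderiv ℝ u z (Complex.I • v) * Complex.I_mul_I

theorem DifferentiableAt.dbar {u : AffChart N → ℂ} {z : AffChart N} (hu : ContDiffAt ℝ 2 u z) :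
    DifferentiableAt ℝ (dbar u) z := by
  have h1 : DifferentiableAt ℝ (fderiv ℝ u) z :=
    (hu.fderiv_right (m := 1) (by norm_num)).differentiableAt (by norm_num)
  unfold _root_.dbar
  exact (h1.add ((h1.clm_comp (differentiableAt_const _)).const_smul Complex.I)).const_smul
    (1 / 2 : ℂ)

theorem differentiableAt_ofSubsingleton {ω : AffChart N → AffChart N →L[ℝ] ℂ} {z : AffChart N}
    (hω : DifferentiableAt ℝ ω z) : DifferentiableAt ℝ
      (fun w => ContinuousAlternatingMap.ofSubsingleton ℝ (AffChart N) ℂ (0 : Fin 1) (ω w)) z :=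
  ((ContinuousAlternatingMap.ofSubsingletonLIE (𝕜 := ℝ) (E := AffChart N) (F := ℂ)
    (0 : Fin 1)).differentiable.differentiableAt).comp z hω

/-- Makes `∂∂̄u = 0` the symmetry of the derivative of `∂̄u`, the hypothesis of the Poincaré lemma.
-/
theorem ddbar_apply {u : AffChart N → ℂ} {z : AffChart N} (hu : ContDiffAt ℝ 2 u z)
    (x y : AffChart N) :
    ddbar u z ![x, y] = fderiv ℝ (dbar u) z x y - fderiv ℝ (dbar u) z y x := by
  have hd := DifferentiableAt.dbar hu
  rw [ddbar, extDeriv_apply (differentiableAt_ofSubsingleton hd), Fin.sum_univ_two]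
  have h : ∀ x y : AffChart N, fderiv ℝ (fun w => dbar u w x) z y = fderiv ℝ (dbar u) z y x :=
    fun x y => by
      rw [fderiv_clm_apply hd (differentiableAt_const x)]
      simp
  simp [Fin.removeNth, h, sub_eq_add_neg]

theorem ddbar_add {u v : AffChart N → ℂ} {z : AffChart N} (hu : ContDiffAt ℝ 2 u z)
    (hv : ContDiffAt ℝ 2 v z) : ddbar (fun w => u w + v w) z = ddbar u z + ddbar v z := by
  rw [ddbar, ddbar, ddbar, ← extDeriv_fun_add (differentiableAt_ofSubsingleton (.dbar hu))
    (differentiableAt_ofSubsingleton (.dbar hv))]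
  refine Filter.EventuallyEq.extDeriv_eq ?_
  filter_upwards [hu.eventually (by simp), hv.eventually (by simp)] with w hw hw'
  ext x
  simp only [ContinuousAlternatingMap.add_apply, ContinuousAlternatingMap.ofSubsingleton_apply_apply,
    dbar_apply, fderiv_fun_add (hw.differentiableAt (by norm_num))
      (hw'.differentiableAt (by norm_num)), add_apply]
  ring

theorem ddbar_const_smul {u : AffChart N → ℂ} {z : AffChart N} (hu : ContDiffAt ℝ 2 u z)
    (c : ℝ) : ddbar (fun w => c • u w) z = c • ddbar u z := by
  rw [ddbar, ddbar, ← extDeriv_fun_smul]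
  refine Filter.EventuallyEq.extDeriv_eq ?_
  filter_upwards [hu.eventually (by simp)] with w hw
  ext x
  have h := fderiv_fun_const_smul (𝕜 := ℝ) (hw.differentiableAt (by norm_num)) c
  simp only [ContinuousAlternatingMap.smul_apply, ContinuousAlternatingMap.ofSubsingleton_apply_apply,
    dbar_apply, h, FunLike.coe_smul, Pi.smul_apply]
  simp only [Complex.real_smul]
  ring

/-- `∂∂̄` commutes with pullback along holomorphic maps. -/
theorem ddbar_comp {φ : AffChart n → AffChart N} {Ω : Set (AffChart n)} (hΩ : IsOpen Ω)
    (hφ : DifferentiableOn ℂ φ Ω) {u : AffChart N → ℂ} (hu : ContDiff ℝ 2 u) {z : AffChart n}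
    (hz : z ∈ Ω) (hφz : ContDiffAt ℝ 2 φ z) :
    ddbar (fun w => u (φ w)) z = pullbackForm φ (ddbar u) z := by
  rw [pullbackForm, ddbar, ddbar, ← extDeriv_pullback
    (differentiableAt_ofSubsingleton (DifferentiableAt.dbar hu.contDiffAt)) hφz
    (by simp)]
  refine Filter.EventuallyEq.extDeriv_eq ?_
  filter_upwards [hΩ.mem_nhds hz] with w hw
  have hφw : DifferentiableAt ℂ φ w := hφ.differentiableAt (hΩ.mem_nhds hw)
  have hφI : ∀ v : AffChart n, fderiv ℝ φ w (Complex.I • v) = Complex.I • fderiv ℝ φ w v := by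
    intro v
    rw [hφw.fderiv_restrictScalars ℝ]
    simp
  have hcomp : fderiv ℝ (fun w => u (φ w)) w = (fderiv ℝ u (φ w)).comp (fderiv ℝ φ w) :=
    fderiv_comp w ((hu.differentiable (by norm_num)).differentiableAt) (hφw.restrictScalars ℝ)
  ext x
  simp [dbar_apply, hcomp, hφI]

/-- The real part of a `C²` function `u` on a convex open set with `∂∂̄u = 0` is the real part of a
holomorphic function. -/
theorem exists_holomorphic_re_eq {B : Set (AffChart N)} (hB : IsOpen B) (hc : Convex ℝ B)
    {u : AffChart N → ℂ} (hu : ∀ z ∈ B, ContDiffAt ℝ 2 u z) (hdd : ∀ z ∈ B, ddbar u z = 0) :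
    ∃ G : AffChart N → ℂ, DifferentiableOn ℂ G B ∧ ∀ z ∈ B, (G z).re = (u z).re := by
  have hsymm : ∀ z ∈ B, ∀ x y, fderiv ℝ (dbar u) z x y = fderiv ℝ (dbar u) z y x := by
    intro z hz x y
    have := ddbar_apply (hu z hz) x y
    rw [hdd z hz] at this
    exact (sub_eq_zero.1 this.symm)
  obtain ⟨g, hg⟩ := hc.exists_forall_hasFDerivAt_of_fderiv_symmetric hB
    (fun z hz => (DifferentiableAt.dbar (hu z hz)).differentiableWithinAt) hsymm
  let C : ℂ →L[ℝ] ℂ := Complex.conjCLE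
  -- Since `dg = ∂̄u`, the differential is `∂u` plus the conjugate of `∂̄u`, both complex linear;
  -- `-g + conj g` is purely imaginary.
  refine ⟨fun z => u z - g z + C (g z), fun z hz => ?_, fun z hz => ?_⟩
  · have hud : HasFDerivAt u (fderiv ℝ u z) z :=
      ((hu z hz).differentiableAt (by norm_num)).hasFDerivAt
    have hd := (hud.sub (hg z hz)).add (C.hasFDerivAt.comp z (hg z hz))
    set L := fderiv ℝ u z - dbar u z + C.comp (dbar u z) with hL
    have hLI : ∀ v, L (Complex.I • v) = Complex.I • L v := by
      intro v
      simp only [hL, FunLike.coe_add, FunLike.coe_sub, Pi.add_apply, Pi.sub_apply,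
        ContinuousLinearMap.comp_apply, dbar_I_smul, smul_eq_mul]
      have h1 : C (-Complex.I * dbar u z v) = Complex.I * C (dbar u z v) := by
        simp [C]
      rw [h1, dbar_apply]
      linear_combination fderiv ℝ u z (Complex.I • v) * Complex.I_mul_I
    have hLc : ∀ (c : ℂ) (v : AffChart N), L (c • v) = c • L v := by
      intro c v
      have : c • v = c.re • v + c.im • (Complex.I • v) := by
        conv_lhs => rw [← Complex.re_add_im c, add_smul, mul_smul]
        rfl
      rw [this, map_add, map_smul, map_smul, hLI]
      conv_rhs => rw [← Complex.re_add_im c, add_smul, mul_smul]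
      rfl
    let L' : AffChart N →L[ℂ] ℂ := ⟨{ L.toLinearMap with map_smul' := hLc }, L.continuous⟩
    have : HasFDerivAt (𝕜 := ℂ) (fun z => u z - g z + C (g z)) L' z :=
      hasFDerivAt_of_restrictScalars ℝ hd rfl
    exact this.differentiableAt.differentiableWithinAt
  · simp [C]

end Ddbar

/-! ### Ranks of holomorphic mappings -/

section Ranks

open Filter Topology

variable {n N : ℕ}

theorem componentSpan_mul {ι κ : Type} (α : AffChart n → ι → ℂ) (β : AffChart n → κ → ℂ) :
    componentSpan (fun z (q : ι × κ) => α z q.1 * β z q.2) =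
      componentSpan α * componentSpan β := by
  rw [componentSpan, componentSpan, componentSpan, Submodule.span_mul_span]
  congr 1
  ext f
  rw [Set.mem_mul]
  constructor
  · rintro ⟨q, rfl⟩
    exact ⟨_, ⟨q.1, rfl⟩, _, ⟨q.2, rfl⟩, rfl⟩
  · rintro ⟨_, ⟨i, rfl⟩, _, ⟨j, rfl⟩, rfl⟩
    exact ⟨(i, j), rfl⟩

/-- By the identity theorem, the rank of a space of holomorphic functions can be computed on a
ball. -/
theorem rankOn_ball_eq {Ω : Set (AffChart n)} (hΩ : IsOpen Ω) (hc : IsPreconnected Ω)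
    {p : AffChart n} {R : ℝ} (hR : 0 < R) (hB : Metric.ball p R ⊆ Ω)
    {V : Submodule ℂ (AffChart n → ℂ)} (hV : ∀ f ∈ V, DifferentiableOn ℂ f Ω) :
    rankOn (Metric.ball p R) V = rankOn Ω V := by
  let i : (Ω → ℂ) →ₗ[ℂ] (Metric.ball p R → ℂ) := LinearMap.funLeft ℂ ℂ (Set.inclusion hB)
  set W := V.map (restrictHom Ω).toLinearMap with hW
  have hmap : V.map (restrictHom (Metric.ball p R)).toLinearMap =
      LinearMap.range (i.domRestrict W) := by
    rw [LinearMap.range_domRestrict, hW, ← Submodule.map_comp]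
    rfl
  rw [rankOn, hmap, rankOn, LinearMap.finrank_range_of_inj]
  rw [injective_iff_map_eq_zero]
  rintro ⟨_, f, hf, rfl⟩ h0
  have hz : Set.EqOn f 0 Ω := by
    refine (hV f hf).eqOn_zero_of_isPreconnected hΩ hc (hB (Metric.mem_ball_self hR)) ?_
    filter_upwards [Metric.ball_mem_nhds p hR] with z hz
    exact congrFun h0 ⟨z, hz⟩
  ext z
  exact hz z.2

theorem differentiableOn_of_mem_componentSpan {ι : Type} {Ω : Set (AffChart n)}
    {ψ : AffChart n → ι → ℂ} (hψ : ∀ j, DifferentiableOn ℂ (fun z => ψ z j) Ω) :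
    ∀ f ∈ componentSpan ψ, DifferentiableOn ℂ f Ω := by
  intro f hf
  induction hf using Submodule.span_induction with
  | mem f hf => obtain ⟨j, rfl⟩ := hf; exact hψ j
  | zero => exact differentiableOn_const 0
  | add f g _ _ hf hg => exact hf.add hg
  | smul c f _ hf => exact hf.const_smul c

theorem differentiableOn_consOne {φ : AffChart n → AffChart N} {Ω : Set (AffChart n)}
    (hφ : DifferentiableOn ℂ φ Ω) (j : Fin (N + 1)) :
    DifferentiableOn ℂ (fun z => consOne φ z j) Ω := by
  refine Fin.cases ?_ (fun i => ?_) j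
  · simp [consOne]
  · simpa [consOne] using (differentiableOn_euclidean.1 hφ) i

theorem differentiableOn_tensorPower {ι : Type} {Ω : Set (AffChart n)}
    {ψ : AffChart n → ι → ℂ} (hψ : ∀ j, DifferentiableOn ℂ (fun z => ψ z j) Ω) (c : ℕ)
    (J : Fin c → ι) : DifferentiableOn ℂ (fun z => tensorPower ψ c z J) Ω :=
  fun z hz => (HasFDerivWithinAt.finsetProd (u := Finset.univ) fun i _ =>
    (hψ (J i) z hz).hasFDerivWithinAt).differentiableWithinAt

/-- A minimally embedded mapping has affinely independent components. -/
theorem MinimallyEmbedded.componentRank_consOne {Ω : Set (AffChart n)} (hne : Ω.Nonempty)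
    {φ : AffChart n → AffChart N} (hφ : MinimallyEmbedded Ω φ) :
    componentRank Ω (consOne φ) = N + 1 := by
  have hli : LinearIndependent ℂ fun (j : Fin (N + 1)) (z : Ω) => consOne φ z j := by
    rw [Fintype.linearIndependent_iff]
    intro c hc
    have hz : ∀ z ∈ Ω, c 0 + ∑ i : Fin N, c i.succ * φ z i = 0 := by
      intro z hz
      have := congrFun hc ⟨z, hz⟩
      simpa [Fin.sum_univ_succ, consOne] using this
    let l : AffChart N →ₗ[ℂ] ℂ :=
      { toFun := fun w => ∑ i : Fin N, c i.succ * w i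
        map_add' := fun x y => by simp [mul_add, Finset.sum_add_distrib]
        map_smul' := fun s x => by simp [Finset.mul_sum, mul_left_comm] }
    obtain ⟨z₀, hz₀⟩ := hne
    -- A linear relation among the components of `(1, φ)` puts the image in a translate of `ker l`;
    -- minimality makes `l` zero.
    have htop := hφ (AffineSubspace.mk' (φ z₀) (LinearMap.ker l)) (by
      rintro _ ⟨z, hzΩ, rfl⟩
      rw [SetLike.mem_coe, AffineSubspace.mem_mk', LinearMap.mem_ker, vsub_eq_sub, map_sub]
      have h1 := hz z hzΩ
      have h2 := hz z₀ hz₀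
      show ∑ i : Fin N, c i.succ * φ z i - ∑ i : Fin N, c i.succ * φ z₀ i = 0
      linear_combination h1 - h2)
    have hdir := congrArg AffineSubspace.direction htop
    rw [AffineSubspace.direction_mk', AffineSubspace.direction_top] at hdir
    have hsucc : ∀ i : Fin N, c i.succ = 0 := by
      intro i
      have h1 : l (EuclideanSpace.single i 1) = 0 :=
        LinearMap.mem_ker.1 (hdir ▸ Submodule.mem_top)
      simpa [l] using h1
    have h0 : c 0 = 0 := by simpa [hsucc] using hz z₀ hz₀
    exact fun i => Fin.cases h0 hsucc i
  rw [componentRank, finrank_span_eq_card hli, Fintype.card_fin]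

theorem sum_normSq_consOne (φ : AffChart n → AffChart N) (z : AffChart n) :
    ∑ j, ‖consOne φ z j‖ ^ 2 = 1 + ‖φ z‖ ^ 2 := by
  rw [Fin.sum_univ_succ, EuclideanSpace.norm_sq_eq]
  simp [consOne]

theorem sum_normSq_tensorPower {ι : Type} [Fintype ι] (ψ : AffChart n → ι → ℂ) (c : ℕ)
    (z : AffChart n) :
    ∑ J, ‖tensorPower ψ c z J‖ ^ 2 = (∑ j, ‖ψ z j‖ ^ 2) ^ c := by
  classical
  rw [Fintype.sum_pow]
  simp [tensorPower, norm_prod, Finset.prod_pow]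

end Ranks

/-! ### Integrating the relation between the Fubini–Study forms -/

section Potential

variable {n N : ℕ}

/-- The Fubini–Study potential `log (1 + ‖w‖²)`. -/
def fubiniStudyPotential (N : ℕ) (w : AffChart N) : ℂ := ((Real.log (1 + ‖w‖ ^ 2) : ℝ) : ℂ)

theorem contDiff_fubiniStudyPotential (N : ℕ) : ContDiff ℝ 2 (fubiniStudyPotential N) := by
  refine Complex.ofRealCLM.contDiff.comp (ContDiff.log (contDiff_const.add (contDiff_norm_sq ℂ)) ?_)
  intro w
  positivity

theorem DifferentiableOn.contDiffAt_real {Ω : Set (AffChart n)} (hΩ : IsOpen Ω)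
    {φ : AffChart n → AffChart N} (hφ : DifferentiableOn ℂ φ Ω) {z : AffChart n} (hz : z ∈ Ω) :
    ContDiffAt ℝ 2 φ z := by
  have h : ContDiffOn ℂ 2 φ Ω := contDiffOn_euclidean.2 fun i =>
    ((differentiableOn_euclidean.1 hφ) i).contDiffOn_nat hΩ 2
  exact (h.contDiffAt (hΩ.mem_nhds hz)).restrict_scalars ℝ

/-- The relation between the Fubini–Study forms integrates, on a ball, to a relation between the
potentials up to the real part of a holomorphic function. -/
theorem exists_holomorphic_re_eq_log {d m a b c : ℕ} (hb : 0 < b) {Ω : Set (AffChart n)}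
    (hΩ : IsOpen Ω) {f : AffChart n → AffChart d} (hf : DifferentiableOn ℂ f Ω)
    {h : AffChart n → AffChart m} (hh : DifferentiableOn ℂ h Ω)
    (hω : ∀ z ∈ Ω, fubiniStudy n z =
      ((a : ℝ) / (b : ℝ)) • pullbackForm h (fubiniStudy m) z -
        ((c : ℝ) / (b : ℝ)) • pullbackForm f (fubiniStudy d) z)
    {p : AffChart n} {R : ℝ} (hB : Metric.ball p R ⊆ Ω) :
    ∃ G : AffChart n → ℂ, DifferentiableOn ℂ G (Metric.ball p R) ∧ ∀ z ∈ Metric.ball p R,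
      (G z).re = b * Real.log (1 + ‖z‖ ^ 2) + c * Real.log (1 + ‖f z‖ ^ 2) -
        a * Real.log (1 + ‖h z‖ ^ 2) := by
  have hn := contDiff_fubiniStudyPotential n
  have hd := contDiff_fubiniStudyPotential d
  have hm := contDiff_fubiniStudyPotential m
  have hfz : ∀ z ∈ Ω, ContDiffAt ℝ 2 (fun w => fubiniStudyPotential d (f w)) z := fun z hz =>
    hd.contDiffAt.comp z (hf.contDiffAt_real hΩ hz)
  have hhz : ∀ z ∈ Ω, ContDiffAt ℝ 2 (fun w => fubiniStudyPotential m (h w)) z := fun z hz =>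
    hm.contDiffAt.comp z (hh.contDiffAt_real hΩ hz)
  let u : AffChart n → ℂ := fun z => ((b : ℝ) • fubiniStudyPotential n z +
    (c : ℝ) • fubiniStudyPotential d (f z)) + (-(a : ℝ)) • fubiniStudyPotential m (h z)
  have hu : ∀ z ∈ Metric.ball p R, ContDiffAt ℝ 2 u z := fun z hz =>
    ((hn.contDiffAt.const_smul _).add ((hfz z (hB hz)).const_smul _)).add
      ((hhz z (hB hz)).const_smul _)
  have hdd : ∀ z ∈ Metric.ball p R, ddbar u z = 0 := by
    intro z hz
    have hzΩ := hB hz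
    rw [ddbar_add ((hn.contDiffAt.const_smul _).add ((hfz z hzΩ).const_smul _))
        ((hhz z hzΩ).const_smul _),
      ddbar_add (hn.contDiffAt.const_smul _) ((hfz z hzΩ).const_smul _),
      ddbar_const_smul hn.contDiffAt, ddbar_const_smul (hfz z hzΩ), ddbar_const_smul (hhz z hzΩ),
      ddbar_comp hΩ hf hd hzΩ (hf.contDiffAt_real hΩ hzΩ),
      ddbar_comp hΩ hh hm hzΩ (hh.contDiffAt_real hΩ hzΩ)]
    have hz' := hω z hzΩ
    ext v
    have hv := congrArg (fun ω => ω v) hz'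
    have e1 : fubiniStudy n z v =
        (Complex.I / (2 * (Real.pi : ℂ))) * ddbar (fubiniStudyPotential n) z v := rfl
    have e2 : pullbackForm f (fubiniStudy d) z v = (Complex.I / (2 * (Real.pi : ℂ))) *
        pullbackForm f (ddbar (fubiniStudyPotential d)) z v := rfl
    have e3 : pullbackForm h (fubiniStudy m) z v = (Complex.I / (2 * (Real.pi : ℂ))) *
        pullbackForm h (ddbar (fubiniStudyPotential m)) z v := rfl
    simp only [ContinuousAlternatingMap.sub_apply, ContinuousAlternatingMap.smul_apply,
      Complex.real_smul, e1, e2, e3] at hv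
    simp only [ContinuousAlternatingMap.add_apply, ContinuousAlternatingMap.smul_apply,
      Complex.real_smul, ContinuousAlternatingMap.coe_zero, Pi.zero_apply]
    have hκ : Complex.I / (2 * (Real.pi : ℂ)) ≠ 0 :=
      div_ne_zero Complex.I_ne_zero (mul_ne_zero two_ne_zero
        (Complex.ofReal_ne_zero.2 Real.pi_ne_zero))
    have hb' : (b : ℂ) ≠ 0 := Nat.cast_ne_zero.2 hb.ne'
    push_cast at hv ⊢
    refine (mul_eq_zero.1 (?_ : Complex.I / (2 * (Real.pi : ℂ)) * _ = 0)).resolve_left hκ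
    have h1 : (b : ℂ) * (a / b) = a := mul_div_cancel₀ _ hb'
    have h2 : (b : ℂ) * (c / b) = c := mul_div_cancel₀ _ hb'
    linear_combination (b : ℂ) * hv +
      Complex.I / (2 * (Real.pi : ℂ)) * pullbackForm h (ddbar (fubiniStudyPotential m)) z v * h1 -
      Complex.I / (2 * (Real.pi : ℂ)) * pullbackForm f (ddbar (fubiniStudyPotential d)) z v * h2
  obtain ⟨G, hG, hGre⟩ := exists_holomorphic_re_eq Metric.isOpen_ball (convex_ball p R) hu hdd
  refine ⟨G, hG, fun z hz => ?_⟩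
  rw [hGre z hz]
  simp [u, fubiniStudyPotential, sub_eq_add_neg]

/-- Comparison of ranks: the mappings on the two sides of the integrated equation span spaces of
the same dimension. -/
theorem rankOn_mul_eq_rankOn_pow {d m a b c : ℕ} (hb : 0 < b) {Ω : Set (AffChart n)}
    (hΩ : IsOpen Ω) {f : AffChart n → AffChart d} (hf : DifferentiableOn ℂ f Ω)
    {h : AffChart n → AffChart m} (hh : DifferentiableOn ℂ h Ω)
    (hω : ∀ z ∈ Ω, fubiniStudy n z =
      ((a : ℝ) / (b : ℝ)) • pullbackForm h (fubiniStudy m) z -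
        ((c : ℝ) / (b : ℝ)) • pullbackForm f (fubiniStudy d) z)
    {p : AffChart n} {R : ℝ} (hB : Metric.ball p R ⊆ Ω) :
    rankOn (Metric.ball p (R / 4)) (componentSpan (consOne fun z : AffChart n => z) ^ b *
        componentSpan (consOne f) ^ c) =
      rankOn (Metric.ball p (R / 4)) (componentSpan (consOne h) ^ a) := by
  obtain ⟨G, hG, hGre⟩ := exists_holomorphic_re_eq_log hb hΩ hf hh hω hB
  have hz : ∀ b J, DifferentiableOn ℂ
      (fun z => tensorPower (consOne fun z : AffChart n => z) b z J) (Metric.ball p R) :=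
    differentiableOn_tensorPower (differentiableOn_consOne differentiableOn_id)
  have hft : ∀ c J, DifferentiableOn ℂ (fun z => tensorPower (consOne f) c z J)
      (Metric.ball p R) :=
    differentiableOn_tensorPower (differentiableOn_consOne (hf.mono hB))
  have hht : ∀ a J, DifferentiableOn ℂ (fun z => tensorPower (consOne h) a z J)
      (Metric.ball p R) :=
    differentiableOn_tensorPower (differentiableOn_consOne (hh.mono hB))
  -- Half of `G`, because `|e^{G/2}|² = e^{Re G}`.
  have hexp : DifferentiableOn ℂ (fun z => Complex.exp (G z / 2)) (Metric.ball p R) := by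
    simpa only [div_eq_mul_inv] using (hG.mul_const ((2 : ℂ)⁻¹)).cexp
  have hspan := span_range_eq_of_sum_normSq_eq (p := p) (R := R)
    (φ := fun z (q : (Fin b → Fin (n + 1)) × (Fin c → Fin (d + 1))) =>
      tensorPower (consOne fun z : AffChart n => z) b z q.1 * tensorPower (consOne f) c z q.2)
    (ψ := fun z J => Complex.exp (G z / 2) * tensorPower (consOne h) a z J)
    (fun q => (hz b q.1).mul (hft c q.2)) (fun J => hexp.mul (hht a J)) ?_
  · rw [← componentSpan_tensorPower, ← componentSpan_tensorPower, ← componentSpan_tensorPower,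
      ← componentSpan_mul, rankOn, map_componentSpan, hspan, rankOn, map_componentSpan]
    set S := Metric.ball p (R / 4)
    let E : S → ℂ := fun z => Complex.exp (G z / 2)
    -- Multiplication by the nowhere vanishing `e^{G/2}` preserves dimension, so this factor can be
    -- dropped.
    have hE : Function.Injective (LinearMap.mulLeft ℂ E) := by
      rw [injective_iff_map_eq_zero]
      intro g hg
      ext z
      exact (mul_eq_zero.1 (congrFun hg z)).resolve_left (Complex.exp_ne_zero _)
    have hmap : Submodule.span ℂ (Set.range fun J (z : S) =>
          Complex.exp (G z / 2) * tensorPower (consOne h) a z J) =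
        (Submodule.span ℂ (Set.range fun J (z : S) => tensorPower (consOne h) a z J)).map
          (LinearMap.mulLeft ℂ E) := by
      rw [Submodule.map_span, ← Set.range_comp]
      rfl
    rw [hmap]
    exact (LinearEquiv.finrank_eq (Submodule.equivMapOfInjective _ hE _)).symm
  · intro z hzB
    have hpos : ∀ {k : ℕ} (w : AffChart k), 0 < 1 + ‖w‖ ^ 2 := fun w => by positivity
    simp only [norm_mul, mul_pow, Fintype.sum_prod_type]
    rw [← Finset.mul_sum, sum_normSq_tensorPower, sum_normSq_consOne,
      ← Finset.sum_mul_sum, sum_normSq_tensorPower, sum_normSq_tensorPower, sum_normSq_consOne,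
      sum_normSq_consOne, Complex.norm_exp, ← Real.exp_nat_mul]
    have hre : ((2 : ℕ) : ℝ) * (G z / 2).re = (G z).re := by
      simp
      ring
    rw [hre, hGre z hzB, Real.exp_sub, Real.exp_add, Real.exp_nat_mul, Real.exp_nat_mul,
      Real.exp_nat_mul, Real.exp_log (hpos _), Real.exp_log (hpos _), Real.exp_log (hpos _)]
    exact (div_mul_cancel₀ _ (pow_pos (hpos _) _).ne').symm

end Potential

/-! ### The final dimension count -/

theorem sum_range_sub_eq {n s : ℕ} (hs : s ≤ n + 1) :
    ((∑ k ∈ Finset.range s, (n + 1 - k) : ℕ) : ℝ) = (s : ℝ) * (2 * n + 3 - s) / 2 := by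
  induction s with
  | zero => simp
  | succ s ih =>
    rw [Finset.sum_range_succ, Nat.cast_add, ih (by omega), Nat.cast_sub (by omega)]
    push_cast
    ring

end

theorem theorem3 {n d m : ℕ} (a b c e : ℕ) (ha : 0 < a) (hb : 0 < b) (hc : 0 < c)
    (habc : Nat.gcd (Nat.gcd a b) c = 1)
    (Ω : Set (AffChart n)) (hΩ : IsOpen Ω) (hΩc : IsConnected Ω)
    (f : AffChart n → AffChart d) (hf : DifferentiableOn ℂ f Ω) (hfmin : MinimallyEmbedded Ω f)
    (h : AffChart n → AffChart m) (hh : DifferentiableOn ℂ h Ω) (hhmin : MinimallyEmbedded Ω h)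
    (hω : ∀ z ∈ Ω, fubiniStudy n z =
      ((a : ℝ) / (b : ℝ)) • pullbackForm h (fubiniStudy m) z -
        ((c : ℝ) / (b : ℝ)) • pullbackForm f (fubiniStudy d) z)
    (he : componentRank Ω (tensorPower (consOne f) c) = e + 1) :
    (c * d ≤ e ∧ e ≤ ∑ k ∈ Finset.Icc 1 c, (d + k - 1).choose k) ∧
    (e ≤ n → b = 1 →
      (n : ℝ) * (e + 1) - (e : ℝ) * (e - 1) / 2 ≤
          ((∑ k ∈ Finset.Icc 1 a, (m + k - 1).choose k : ℕ) : ℝ) ∧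
        a * m ≤ n * (e + 1) + e) ∧
    (n ≤ e ∨ 2 ≤ b →
      (n : ℝ) * (n + 3) / 2 ≤ ((∑ k ∈ Finset.Icc 1 a, (m + k - 1).choose k : ℕ) : ℝ)) := by
  obtain ⟨p, hp⟩ := hΩc.nonempty
  obtain ⟨R, hR, hball⟩ := Metric.isOpen_iff.1 hΩ p hp
  have hR4 : 0 < R / 4 := by positivity
  set B := Metric.ball p (R / 4)
  have hBΩ : B ⊆ Ω := (Metric.ball_subset_ball (by linarith)).trans hball
  set Z := componentSpan (consOne fun z : AffChart n => z) with hZ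
  set F := componentSpan (consOne f) with hF
  set H := componentSpan (consOne h) with hH
  have hdiffF : ∀ k, ∀ g ∈ F ^ k, DifferentiableOn ℂ g Ω := fun k => by
    rw [hF, ← componentSpan_tensorPower]
    exact differentiableOn_of_mem_componentSpan
      (differentiableOn_tensorPower (differentiableOn_consOne hf) k)
  have hdiffZ : ∀ g ∈ Z, DifferentiableOn ℂ g B :=
    differentiableOn_of_mem_componentSpan (differentiableOn_consOne differentiableOn_id)
  have hdiffH : ∀ g ∈ H, DifferentiableOn ℂ g Ω :=
    differentiableOn_of_mem_componentSpan (differentiableOn_consOne hh)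
  have hfinF : ∀ k, FiniteDimensional ℂ ((F ^ k).map (restrictHom B).toLinearMap) := fun k => by
    rw [hF, ← componentSpan_tensorPower]
    exact finiteDimensional_map_componentSpan _ _
  have hfinH : ∀ k, FiniteDimensional ℂ ((H ^ k).map (restrictHom B).toLinearMap) := fun k => by
    rw [hH, ← componentSpan_tensorPower]
    exact finiteDimensional_map_componentSpan _ _
  have hfinZ : ∀ k, FiniteDimensional ℂ ((Z ^ k).map (restrictHom B).toLinearMap) := fun k => by
    rw [hZ, ← componentSpan_tensorPower]
    exact finiteDimensional_map_componentSpan _ _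
  have hfinF1 : FiniteDimensional ℂ (F.map (restrictHom B).toLinearMap) :=
    finiteDimensional_map_componentSpan _ _
  have hfinH1 : FiniteDimensional ℂ (H.map (restrictHom B).toLinearMap) :=
    finiteDimensional_map_componentSpan _ _
  have hfinZ1 : FiniteDimensional ℂ (Z.map (restrictHom B).toLinearMap) :=
    finiteDimensional_map_componentSpan _ _
  have hfinZF : FiniteDimensional ℂ ((Z ^ b * F ^ c).map (restrictHom B).toLinearMap) :=
    finiteDimensional_map_mul
  have hrankF : rankOn B F = d + 1 := by
    rw [rankOn_ball_eq hΩ hΩc.isPreconnected hR4 hBΩ (by simpa using hdiffF 1),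
      ← componentRank_eq_rankOn, hfmin.componentRank_consOne hΩc.nonempty]
  have hrankH : rankOn B H = m + 1 := by
    rw [rankOn_ball_eq hΩ hΩc.isPreconnected hR4 hBΩ hdiffH,
      ← componentRank_eq_rankOn, hhmin.componentRank_consOne hΩc.nonempty]
  have hrankFc : rankOn B (F ^ c) = e + 1 := by
    rw [rankOn_ball_eq hΩ hΩc.isPreconnected hR4 hBΩ (hdiffF c), hF, ← componentSpan_tensorPower,
      ← componentRank_eq_rankOn, he]
  have hkey : rankOn B (Z ^ b * F ^ c) = rankOn B (H ^ a) :=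
    rankOn_mul_eq_rankOn_pow hb hΩ hf hh hω hball
  have hupper : rankOn B (H ^ a) ≤ (∑ k ∈ Finset.Icc 1 a, (m + k - 1).choose k) + 1 := by
    rw [sum_choose_add_one, hH, ← componentSpan_tensorPower, ← componentRank_eq_rankOn]
    exact componentRank_tensorPower_le _ _ _
  have hFB : ∀ k, ∀ g ∈ F ^ k, DifferentiableOn ℂ g B := fun k g hg => (hdiffF k g hg).mono hBΩ
  have hF1B : ∀ g ∈ F, DifferentiableOn ℂ g B := by simpa using hFB 1
  have hpowF : ∀ k, k * d + 1 ≤ rankOn B (F ^ k) := fun k =>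
    mul_add_one_le_rankOn_pow hR4 hF1B hrankF
  have hpowH : a * m + 1 ≤ rankOn B (H ^ a) :=
    mul_add_one_le_rankOn_pow hR4 (fun g hg => (hdiffH g hg).mono hBΩ) hrankH
  have h1Z : 1 ≤ Z := Submodule.one_le.2 (mem_componentSpan _ (0 : Fin (n + 1)))
  have h1F : 1 ≤ F := Submodule.one_le.2 (mem_componentSpan _ (0 : Fin (d + 1)))
  -- Sidon bound for `Z · F⁰ = Z` with a single order: the sum is its first term `n + 1`.
  have hrankZ : n + 1 ≤ rankOn B Z := by
    have := sum_le_rankOn_affine_mul hR4 (hFB 0) (s := 1) (by simpa using hpowF 0)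
    simpa using this
  refine ⟨⟨?_, ?_⟩, fun hen hb1 => ⟨?_, ?_⟩, fun hor => ?_⟩
  · have := hpowF c
    omega
  · have h1 := componentRank_tensorPower_le Ω (consOne f) c
    rw [he, ← sum_choose_add_one] at h1
    omega
  · subst hb1
    have h1 := sum_le_rankOn_affine_mul hR4 (hFB c) (s := e + 1) hrankFc.ge
    rw [pow_one] at hkey
    have h2 := (h1.trans hkey.le).trans hupper
    -- The closed form equals `n(e+1) - e(e-1)/2 + 1`, and the extra 1 cancels the constant monomial
    -- in the upper bound; `e ≤ n` keeps the subtractions exact.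
    have h3 := sum_range_sub_eq (n := n) (s := e + 1) (by omega)
    have h4 : ((∑ k ∈ Finset.range (e + 1), (n + 1 - k) : ℕ) : ℝ) ≤
        ((∑ k ∈ Finset.Icc 1 a, (m + k - 1).choose k) + 1 : ℕ) := Nat.cast_le.2 h2
    rw [h3, Nat.cast_add, Nat.cast_add] at h4
    push_cast at h4 ⊢
    linarith
  · subst hb1
    rw [pow_one] at hkey
    have h1 := rankOn_mul_le B Z (F ^ c)
    have h2 : rankOn B Z ≤ n + 1 := by
      simpa using rankOn_componentSpan_le B (consOne fun z : AffChart n => z)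
    rw [hkey, hrankFc] at h1
    have h3 := h1.trans (Nat.mul_le_mul_right (e + 1) h2)
    have h4 := hpowH.trans h3
    linarith
  -- Both cases use `n + 1` orders: those of `F ^ c` when `n ≤ e`, those of a second factor `Z` when
  -- `2 ≤ b`. Since `Z` and `F` contain `1`, the product used lies in `Z ^ b * F ^ c`.
  · have h1 : ∑ k ∈ Finset.range (n + 1), (n + 1 - k) ≤ rankOn B (Z ^ b * F ^ c) := by
      rcases hor with hne | hb2
      · have h1 := sum_le_rankOn_affine_mul hR4 (hFB c) (s := n + 1)
          (show n + 1 ≤ rankOn B (F ^ c) by omega)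
        exact h1.trans (rankOn_mono (mul_le_mul' (le_self_pow₀ h1Z hb.ne') le_rfl))
      · have h1 := sum_le_rankOn_affine_mul hR4 hdiffZ (s := n + 1) hrankZ
        refine h1.trans (rankOn_mono ?_)
        calc Z * Z = Z ^ 2 * 1 := by rw [pow_two, mul_one]
          _ ≤ Z ^ b * F ^ c := mul_le_mul' (pow_le_pow_right₀ h1Z hb2) (one_le_pow₀ h1F)
    have h2 := (h1.trans hkey.le).trans hupper
    have h3 := sum_range_sub_eq (n := n) (s := n + 1) le_rfl
    have h4 : ((∑ k ∈ Finset.range (n + 1), (n + 1 - k) : ℕ) : ℝ) ≤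
        ((∑ k ∈ Finset.Icc 1 a, (m + k - 1).choose k) + 1 : ℕ) := Nat.cast_le.2 h2
    rw [h3, Nat.cast_add] at h4
    push_cast at h4 ⊢
    linarith
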